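/- **Setting.** Let $K,d\ge 1$, let $P=\{x\in\mathbb R^d: \mathbf A x\le b\}$ be a known polyhedron, and for $\sigma,\sigma_u>0$ let $\mathcal D$ be the class of distributions on $\mathbb R^d$ that are marginally $\sigma$-subGaussian (each centred coordinate is $\sigma$-subGaussian) and norm-$\sigma_u$-subGaussian ($z^\top(X-\mathbb E X)$ is $\sigma_u$-subGaussian for every unit vector $z$). An instance is $\nu=(\nu_1,\dots,\nu_K)\in\mathcal D^K$ with means $\mu_1,\dots,\mu_K$; successive pulls of arm $i$ give independent observations with law $\nu_i$, independent of those of the other arms. Write $x\prec y$ if $x^c\le y^c$ for all coordinates $c$; $M(i,j)=\max_c(\mu_i^c-\mu_j^c)$ and $m(i,j)=\min_c(\mu_j^c-\mu_i^c)$; $F=\{i:\mu_i\in P\}$; for $S\subset[K]$ let $\mathrm{Par}(S)$ be the set of $i\in S$ with $\mu_i\not\prec\mu_j$ for all $j\in S\setminus\{i\}$; $O^*=\mathrm{Par}(F)$; $\mathrm{SubOpt}=\{i:\exists j\in F\setminus\{i\},\ \mu_i\prec\mu_j\}$; $\eta_i=\mathrm{dist}(\mu_i,P)$ if $\mu_i\notin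 P$ and $\eta_i=\mathrm{dist}(\mu_i,P^c)$ if $\mu_i\in P$. Throughout $\min\emptyset=\mathrm{dist}(\cdot,\emptyset)=+\infty$ and $\max\emptyset=-\infty$. The valid answers are $$\mathcal M=\{(S,I): S\subset\mathrm{SubOpt},\ I\subset F^c,\ S\cap I=\emptyset,\ S\cup I=(O^*)^c\}.$$ An algorithm with stopping time $\tau$ that outputs a partition $(O_\tau,S_\tau,I_\tau)$ of $[K]$ is $\delta$-correct on $\mathcal D^K$ if for all $\nu\in\mathcal D^K$, $\mathbb P_\nu\big(\tau<\infty\text{ and not }(O_\tau=O^*,\ (S_\tau,I_\tau)\in\mathcal M)\big)\le\delta$. **Algorithm e-cAPE.** Let $f(t,\delta)=\log(4k_1Kdt^\alpha/\delta)$ and $g(t,\delta)=4\log(4k_1K5^dt^\alpha/\delta)$. Pull each arm once. In round $t=K+1,K+2,\dots$ let $N_{t,i}$ be the number of pulls of arm $i$ so far and $\hat\mu_{t,i}$ its empirical mean; let $\hat M,\hat m,\hat\eta_i$ be the quantities above computed from the $\hat\mu_{t,i}$; put $\beta_i=\sqrt{2\sigma^2f(t,\delta)/N_{t,i}}$, $\hat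 M^-(i,j)=\hat M(i,j)-\beta_i-\beta_j$, $\hat m^-(i,j)=\hat m(i,j)-\beta_i-\beta_j$, $\gamma_i=N_{t,i}\hat\eta_i^2/(2\sigma_u^2)-g(t,\delta)$, $F_t=\{i:\hat\mu_{t,i}\in P\}$, $O_t$ the Pareto set of $F_t$ for the empirical means, $G_t=\{i\notin F_t:\gamma_i<0\}$, $\xi_i=\max_{j\in(F_t\cup G_t)\setminus\{i\}}\hat m^-(i,j)$, and $$Z_1^F=\min_{i\in O_t}\gamma_i,\quad Z_1^{PS}=\min_{i\in O_t}\min_{j\in O_t\setminus\{i\}}\hat M^-(i,j),\quad Z_1=\min(Z_1^F,Z_1^{PS}),\quad Z_2=\min_{i\notin O_t}\begin{cases}\xi_i& i\in F_t\\ \max(\gamma_i,\xi_i)& i\notin F_t.\end{cases}$$ If $Z_1\ge0$ and $Z_2\ge0$, stop with $\tau=t$ and output $(O_t,(F_t\cup G_t)\setminus O_t,F_t^c\cap G_t^c)$. Otherwise let the leader $b_t$ be a minimizer in $Z_2$ if $Z_2<0$, and else a minimizer in $Z_1^F$ if $Z_1^F\le Z_1^{PS}$ and in $Z_1^{PS}$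 if not; let the challenger $c_t$ be a minimizer of $\hat M^-(b_t,j)$ over $j\in(F_t\cup G_t)\setminus\{b_t\}$; pull $b_t$ and $c_t$ once each (only $b_t$ if there is no candidate for $c_t$). Ties are broken by any rule that depends measurably on the past observations. ($\tau$ is the index of the round, which starts at $K+1$.) **Complexity.** For $i\notin\mathrm{Par}(S)$ let $\Delta_i(S)=\max_{j\in\mathrm{Par}(S)}m(i,j)$; for $i\in\mathrm{Par}(S)$ let $$\Delta_i(S)=\min\Big(\min_{j\in\mathrm{Par}(S)\setminus\{i\}}\min(M(i,j),M(j,i)),\ \min_{j\in S\setminus\mathrm{Par}(S)}\big[(M(j,i))_++\Delta_j(S)\big]\Big).$$ For $(S,I)\in\mathcal M$ let $$C(\nu,S,I)=\sum_{i\in O^*}\max\Big(\frac{2\sigma^2}{\Delta_i(O^*\cup S)^2},\frac{2\sigma_u^2}{\eta_i^2}\Big)+\sum_{i\in S}\frac{2\sigma^2}{\Delta_i(O^*\cup S)^2}+\sum_{i\in I}\frac{2\sigma_u^2}{\eta_i^2},\qquad C^*_{\mathcal M}(\nu)=\min_{(S,I)\in\mathcal M}C(\nu,S,I),$$ where a summand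 is $+\infty$ if its gap is not positive and $0$ if its gap is infinite, and let $H(\nu,F^c)=\sum_{a\in F^c\cup O^*}32\sigma_u^2\log(5^d/d)/\eta_a^2$. **Theorem 1.** Let $\alpha>2$, $k_1>1+\frac1{\alpha-1}$ and $\delta\in(0,1)$. Then e-cAPE is $\delta$-correct on $\mathcal D^K$. Moreover, for every $\nu\in\mathcal D^K$ with $C^*_{\mathcal M}(\nu)<\infty$, $$\mathbb E_\nu[\tau]\le\max\Big(2K+1,\ 128\,\alpha\,C^*_{\mathcal M}(\nu)\log\Big(64\,\alpha\,C^*_{\mathcal M}(\nu)\Big(\frac{4k_1Kd}{\delta}\Big)^{1/\alpha}\Big)\Big)+4H(\nu,F^c)+\Lambda_\alpha,$$ (with $0\log0=0$), where $\Lambda_\alpha$ does not depend on $\delta$ or $\nu$ and is bounded by the convergent series $$\Lambda_\alpha\le\frac{2^{\alpha-1}}{4k_1}\sum_{T\ge1}(\log T+1)\,\frac{f(T,5^{-d}d)+f(T,1)+2/e}{T^{\alpha-1}}.$$ -/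

import Mathlib

open MeasureTheory
open scoped ENNReal

noncomputable section

namespace ECAPE

/-! ### Pareto dominance, feasibility, valid answers -/

/-- `ℝ^d` with the Euclidean norm. -/
abbrev Vec (d : ℕ) : Type := EuclideanSpace ℝ (Fin d)

/-- The polyhedron `{x | A x ≤ v}`. -/
def polyhedron {d m : ℕ} (A : Matrix (Fin m) (Fin d) ℝ) (v : Fin m → ℝ) : Set (Vec d) :=
  {x | ∀ r, ∑ c, A r c * x c ≤ v r}

/-- `Dominated x y` is `x ≺ y`: no coordinate of `x` exceeds that of `y`. -/
def Dominated {d : ℕ} (x y : Vec d) : Prop := ∀ c, x c ≤ y c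

/-- `M = max_c (x^c - y^c)`. -/
def bigM {d : ℕ} (x y : Vec d) : ℝ := ⨆ c, (x c - y c)

/-- `m = min_c (y^c - x^c)`. -/
def smallM {d : ℕ} (x y : Vec d) : ℝ := ⨅ c, (y c - x c)

open Classical in
/-- `η`: the distance to `P` outside of `P`, and the distance to the complement inside of `P`.
The distance to the empty set is `∞`. -/
def eta {d : ℕ} (P : Set (Vec d)) (x : Vec d) : ℝ≥0∞ :=
  if x ∈ P then Metric.infEDist x Pᶜ else Metric.infEDist x P

/-- The arms whose vector lies in `P`. -/
def feasible {K d : ℕ} (P : Set (Vec d)) (y : Fin K → Vec d) : Set (Fin K) := {i | y i ∈ P}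

/-- The arms of `S` that are not dominated by another arm of `S`. -/
def pareto {K d : ℕ} (S : Set (Fin K)) (y : Fin K → Vec d) : Set (Fin K) :=
  {i | i ∈ S ∧ ∀ j ∈ S, j ≠ i → ¬ Dominated (y i) (y j)}

/-- `O*`, the Pareto set of the feasible arms. -/
def optSet {K d : ℕ} (P : Set (Vec d)) (y : Fin K → Vec d) : Set (Fin K) :=
  pareto (feasible P y) y

/-- The arms that are dominated by another, feasible, arm. -/
def subOpt {K d : ℕ} (P : Set (Vec d)) (y : Fin K → Vec d) : Set (Fin K) :=
  {i | ∃ j ∈ feasible P y, j ≠ i ∧ Dominated (y i) (y j)}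

/-- The valid answers `(S, I)`. -/
def validAnswers {K d : ℕ} (P : Set (Vec d)) (y : Fin K → Vec d) :
    Set (Set (Fin K) × Set (Fin K)) :=
  {p | p.1 ⊆ subOpt P y ∧ p.2 ⊆ (feasible P y)ᶜ ∧ p.1 ∩ p.2 = ∅ ∧ p.1 ∪ p.2 = (optSet P y)ᶜ}

/-! ### Gaps and complexities -/

/-- `max_{j ∈ Par(S)} m(i, j)`, equal to `-∞` if the Pareto set of `S` is empty. -/
def subGap {K d : ℕ} (S : Set (Fin K)) (y : Fin K → Vec d) (i : Fin K) : EReal :=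
  ⨆ j ∈ pareto S y, ((smallM (y i) (y j) : ℝ) : EReal)

/-- `δ_i^+(S)`. -/
def gapPlus {K d : ℕ} (S : Set (Fin K)) (y : Fin K → Vec d) (i : Fin K) : EReal :=
  ⨅ j ∈ pareto S y \ {i}, ((min (bigM (y i) (y j)) (bigM (y j) (y i)) : ℝ) : EReal)

/-- `δ_i^-(S)`. -/
def gapMinus {K d : ℕ} (S : Set (Fin K)) (y : Fin K → Vec d) (i : Fin K) : EReal :=
  ⨅ j ∈ S \ pareto S y, (((max (bigM (y j) (y i)) 0 : ℝ) : EReal) + subGap S y j)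

open Classical in
/-- The gap `Δ_i(S)`. -/
def gap {K d : ℕ} (S : Set (Fin K)) (y : Fin K → Vec d) (i : Fin K) : EReal :=
  if i ∈ pareto S y then min (gapPlus S y i) (gapMinus S y i) else subGap S y i

/-- `2 σ² / Δ_i(S)²`; it is `∞` if the gap is not positive, and `0` if the gap is infinite. -/
def gapCost {K d : ℕ} (σ : ℝ) (S : Set (Fin K)) (y : Fin K → Vec d) (i : Fin K) : ℝ≥0∞ :=
  ENNReal.ofReal (2 * σ ^ 2) / (gap S y i).toENNReal ^ 2

/-- `2 σ_u² / η_i²`. -/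
def feasCost {d : ℕ} (σu : ℝ) (P : Set (Vec d)) (x : Vec d) : ℝ≥0∞ :=
  ENNReal.ofReal (2 * σu ^ 2) / eta P x ^ 2

open Classical in
/-- `C(ν, S, I)`. -/
def complexity {K d : ℕ} (σ σu : ℝ) (P : Set (Vec d)) (y : Fin K → Vec d)
    (S I : Set (Fin K)) : ℝ≥0∞ :=
  (∑ i with i ∈ optSet P y, max (gapCost σ (optSet P y ∪ S) y i) (feasCost σu P (y i)))
    + (∑ i with i ∈ S, gapCost σ (optSet P y ∪ S) y i)
    + ∑ i with i ∈ I, feasCost σu P (y i)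

/-- `C*_M(ν)`, the smallest complexity of a valid answer. -/
def minComplexity {K d : ℕ} (σ σu : ℝ) (P : Set (Vec d)) (y : Fin K → Vec d) : ℝ≥0∞ :=
  ⨅ p ∈ validAnswers P y, complexity σ σu P y p.1 p.2

open Classical in
/-- `H(ν, F^c)`, the sum over `F^c ∪ O*` of `32 σ_u² log(5^d / d) / η_a²`. -/
def feasSum {K d : ℕ} (σu : ℝ) (P : Set (Vec d)) (y : Fin K → Vec d) : ℝ≥0∞ :=
  ∑ a with a ∈ (feasible P y)ᶜ ∪ optSet P y,
    ENNReal.ofReal (32 * σu ^ 2 * Real.log (5 ^ d / d)) / eta P (y a) ^ 2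

/-! ### Bandit instances and the sampling model -/

/-- The mean vector of a distribution on `ℝ^d`. -/
def mean {d : ℕ} (ρ : ProbabilityMeasure (Vec d)) : Vec d := ∫ x, x ∂(ρ : Measure (Vec d))

/-- The distributions on `ℝ^d` that are marginally `σ`-subGaussian and norm-`σ_u`-subGaussian. -/
def subGaussianClass (d : ℕ) (σ σu : ℝ) : Set (ProbabilityMeasure (Vec d)) :=
  {ρ | Integrable (fun x : Vec d => x) (ρ : Measure (Vec d)) ∧
    (∀ c, ProbabilityTheory.HasSubgaussianMGF (fun x : Vec d => x c - mean ρ c)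
      (σ ^ 2).toNNReal (ρ : Measure (Vec d))) ∧
    ∀ z : Vec d, ‖z‖ = 1 →
      ProbabilityTheory.HasSubgaussianMGF (fun x : Vec d => inner ℝ z (x - mean ρ))
        (σu ^ 2).toNNReal (ρ : Measure (Vec d))}

/-- A reward table: entry `(i, s)` is the observation made at the `(s+1)`-st pull of arm `i`. -/
abbrev Table (K d : ℕ) : Type := Fin K × ℕ → Vec d

/-- The law of the reward table of the instance `ν`: all entries are independent, and the
entries of arm `i` have the law `ν i`. -/
def tableLaw {K d : ℕ} (ν : Fin K → ProbabilityMeasure (Vec d)) : Measure (Table K d) :=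
  Measure.infinitePi (fun p : Fin K × ℕ => (ν p.1 : Measure (Vec d)))

/-- A recommendation `(O, S, I)`. -/
abbrev Answer (K : ℕ) : Type := Set (Fin K) × Set (Fin K) × Set (Fin K)

/-- The three components form a partition of the arms. -/
def IsPartition {K : ℕ} (R : Answer K) : Prop :=
  R.1 ∪ R.2.1 ∪ R.2.2 = Set.univ ∧
    Disjoint R.1 R.2.1 ∧ Disjoint R.1 R.2.2 ∧ Disjoint R.2.1 R.2.2

/-- The recommendation is correct for the means `y`. -/
def IsCorrect {K d : ℕ} (P : Set (Vec d)) (y : Fin K → Vec d) (R : Answer K) : Prop :=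
  R.1 = optSet P y ∧ (R.2.1, R.2.2) ∈ validAnswers P y

/-- `δ`-correctness on `𝒟^K` of an algorithm with stopping time `τ` and recommendation rule `R`:
it outputs a partition, and on every instance the probability of stopping with a recommendation
that is not correct is at most `δ`. -/
def DeltaCorrect {K d : ℕ} (δ : ℝ) (P : Set (Vec d)) (𝒟 : Set (ProbabilityMeasure (Vec d)))
    (τ : Table K d → ℕ∞) (R : ℕ → Table K d → Answer K) : Prop :=
  (∀ (x : Table K d) (t : ℕ), τ x = t → IsPartition (R t x)) ∧
  ∀ ν : Fin K → ProbabilityMeasure (Vec d), (∀ i, ν i ∈ 𝒟) →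
    tableLaw ν {x | ∃ t : ℕ, τ x = t ∧ ¬ IsCorrect P (fun i => mean (ν i)) (R t x)}
      ≤ ENNReal.ofReal δ

/-! ### The statistics of the algorithm at one round -/

/-- What the algorithm is run with: the feasible region, the two subGaussian parameters, and the
thresholds `f(t, δ)` and `g(t, δ)` as functions of the round `t`. -/
structure Input (d : ℕ) where
  /-- the feasible region -/
  P : Set (Vec d)
  /-- the marginal parameter -/
  σ : ℝ
  /-- the norm parameter -/
  σu : ℝ
  /-- threshold of the coordinatewise bonus -/
  f : ℕ → ℝ
  /-- threshold of the norm bonus -/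
  g : ℕ → ℝ

/-- What the algorithm looks at in a round: the round `t`, the numbers of pulls, and the
empirical means. -/
structure Snapshot (K d : ℕ) where
  /-- the round -/
  t : ℕ
  /-- the numbers of pulls -/
  n : Fin K → ℕ
  /-- the empirical means -/
  y : Fin K → Vec d

section Stats

variable {K d : ℕ} (p : Input d) (s : Snapshot K d)

/-- `β_i(t) = √(2 σ² f(t) / N_{t,i})`. -/
def beta (i : Fin K) : ℝ := Real.sqrt (2 * p.σ ^ 2 * p.f s.t / s.n i)

/-- The lower confidence bound `M^-(i, j; t)`. -/
def bigMLow (i j : Fin K) : ℝ := bigM (s.y i) (s.y j) - (beta p s i + beta p s j)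

/-- The lower confidence bound `m^-(i, j; t)`. -/
def smallMLow (i j : Fin K) : ℝ := smallM (s.y i) (s.y j) - (beta p s i + beta p s j)

/-- `γ_i(t) = N_{t,i} η_i(t)² / (2 σ_u²) - g(t)`. -/
def gam (i : Fin K) : EReal :=
  ((ENNReal.ofReal (s.n i / (2 * p.σu ^ 2)) * eta p.P (s.y i) ^ 2 : ℝ≥0∞) : EReal)
    - ((p.g s.t : ℝ) : EReal)

/-- `F_t`. -/
def setF : Set (Fin K) := feasible p.P s.y

/-- `O_t`. -/
def setO : Set (Fin K) := optSet p.P s.y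

/-- `G_t`: the empirically infeasible arms that are not confidently infeasible. -/
def setG : Set (Fin K) := {i | i ∉ setF p s ∧ gam p s i < 0}

/-- `ξ_i(t)`, with `max ∅ = -∞`. -/
def xi (i : Fin K) : EReal :=
  ⨆ j ∈ (setF p s ∪ setG p s) \ {i}, ((smallMLow p s i j : ℝ) : EReal)

/-- The quantity that `Z_1^PS` minimizes, with `min ∅ = ∞`. -/
def psTerm (i : Fin K) : EReal := ⨅ j ∈ setO p s \ {i}, ((bigMLow p s i j : ℝ) : EReal)

open Classical in
/-- The quantity that `Z_2` minimizes. -/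
def z2Term (i : Fin K) : EReal :=
  if i ∈ setF p s then xi p s i else max (gam p s i) (xi p s i)

/-- `Z_1^F(t)`. -/
def Z1F : EReal := ⨅ i ∈ setO p s, gam p s i

/-- `Z_1^PS(t)`. -/
def Z1PS : EReal := ⨅ i ∈ setO p s, psTerm p s i

/-- `Z_1(t)`. -/
def Z1 : EReal := min (Z1F p s) (Z1PS p s)

/-- `Z_2(t)`. -/
def Z2 : EReal := ⨅ i ∈ (setO p s)ᶜ, z2Term p s i

/-- The stopping condition. -/
def Stops : Prop := 0 ≤ Z1 p s ∧ 0 ≤ Z2 p s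

/-- The recommendation `(O_t, (F_t ∪ G_t) \ O_t, F_t^c ∩ G_t^c)`. -/
def recommend : Answer K :=
  (setO p s, (setF p s ∪ setG p s) \ setO p s, (setF p s)ᶜ ∩ (setG p s)ᶜ)

/-- `i` minimizes `h` over the set `T`. -/
def IsArgmin (T : Set (Fin K)) (h : Fin K → EReal) (i : Fin K) : Prop :=
  i ∈ T ∧ ∀ j ∈ T, h i ≤ h j

/-- `i` is an admissible leader `b_t`. -/
def IsLeader (i : Fin K) : Prop :=
  (Z2 p s < 0 → IsArgmin (setO p s)ᶜ (z2Term p s) i) ∧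
  (0 ≤ Z2 p s → Z1F p s ≤ Z1PS p s → IsArgmin (setO p s) (gam p s) i) ∧
  (0 ≤ Z2 p s → Z1PS p s < Z1F p s → IsArgmin (setO p s) (psTerm p s) i)

/-- `j` is an admissible challenger `c_t` of the leader `i`. If there is no candidate, only the
leader is pulled, which is encoded by `j = i`. -/
def IsChallenger (i j : Fin K) : Prop :=
  (((setF p s ∪ setG p s) \ {i}).Nonempty →
    IsArgmin ((setF p s ∪ setG p s) \ {i}) (fun k => ((bigMLow p s i k : ℝ) : EReal)) j) ∧
  ((setF p s ∪ setG p s) \ {i} = ∅ → j = i)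

end Stats

/-! ### The algorithm -/

section Run

variable {K d : ℕ}

open Classical in
/-- The number of pulls of arm `i` that precede the decision of round `t`: one pull in the
initialization, and one for every round `r ∈ {K+1, …, t-1}` in which `i` is leader or
challenger. -/
def pulls (b c : ℕ → Table K d → Fin K) (t : ℕ) (x : Table K d) (i : Fin K) : ℕ :=
  1 + ((Finset.Ico (K + 1) t).filter (fun r => b r x = i ∨ c r x = i)).card

/-- The empirical mean of arm `i` at round `t`. -/
def empMean (b c : ℕ → Table K d → Fin K) (t : ℕ) (x : Table K d) (i : Fin K) : Vec d :=
  (pulls b c t x i : ℝ)⁻¹ • ∑ r ∈ Finset.range (pulls b c t x i), x (i, r)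

/-- What the algorithm sees at round `t`. -/
def snapshot (b c : ℕ → Table K d → Fin K) (t : ℕ) (x : Table K d) : Snapshot K d :=
  ⟨t, pulls b c t x, empMean b c t x⟩

/-- `b` and `c` are the leaders and challengers of a run of e-cAPE, whatever the way in which
ties between minimizers are broken: in every round the choice is measurable and depends only on
the rewards observed so far, and in every round `t ≥ K + 1` at which the algorithm does not stop
it follows the sampling rule. -/
structure IsECAPE (p : Input d) (b c : ℕ → Table K d → Fin K) : Prop where
  measurable_leader : ∀ t, Measurable (b t)
  measurable_challenger : ∀ t, Measurable (c t)
  nonanticipating : ∀ (t : ℕ) (x x' : Table K d),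
    (∀ i r, r < pulls b c t x i → x (i, r) = x' (i, r)) → b t x = b t x' ∧ c t x = c t x'
  rule : ∀ (t : ℕ) (x : Table K d), K + 1 ≤ t → ¬ Stops p (snapshot b c t x) →
    IsLeader p (snapshot b c t x) (b t x) ∧ IsChallenger p (snapshot b c t x) (b t x) (c t x)

/-- The stopping time `τ`: the first round `t ≥ K + 1` at which the stopping condition holds,
and `∞` if there is none. -/
def stopTime (p : Input d) (b c : ℕ → Table K d → Fin K) (x : Table K d) : ℕ∞ :=
  ⨅ (t : ℕ) (_ : K + 1 ≤ t ∧ Stops p (snapshot b c t x)), (t : ℕ∞)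

/-- The recommendation rule `R_t`. -/
def recommendation (p : Input d) (b c : ℕ → Table K d → Fin K) (t : ℕ) (x : Table K d) :
    Answer K :=
  recommend p (snapshot b c t x)

end Run

/-! ### The thresholds and the constant term -/

/-- `f(t, δ) = log(4 k₁ K d t^α / δ)`. -/
def fThr (K d : ℕ) (α k₁ : ℝ) (t : ℕ) (δ : ℝ) : ℝ :=
  Real.log (4 * k₁ * K * d * (t : ℝ) ^ α / δ)

/-- `g(t, δ) = 4 log(4 k₁ K 5^d t^α / δ)`. -/
def gThr (K d : ℕ) (α k₁ : ℝ) (t : ℕ) (δ : ℝ) : ℝ :=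
  4 * Real.log (4 * k₁ * K * 5 ^ d * (t : ℝ) ^ α / δ)

/-- The input of e-cAPE at confidence level `δ`. -/
def input (K : ℕ) {d : ℕ} (P : Set (Vec d)) (σ σu α k₁ δ : ℝ) : Input d :=
  ⟨P, σ, σu, fun t => fThr K d α k₁ t δ, fun t => gThr K d α k₁ t δ⟩

/-- The term of index `T` in the series that bounds `Λ_α`. -/
def lambdaTerm (K d : ℕ) (α k₁ : ℝ) (T : ℕ) : ℝ :=
  (Real.log T + 1) *
    ((fThr K d α k₁ T (d / 5 ^ d) + fThr K d α k₁ T 1 + 2 / Real.exp 1) / (T : ℝ) ^ (α - 1))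

/-- `2^(α-1) / (4 k₁)` times the sum over `T ≥ 1`. -/
def lambdaBound (K d : ℕ) (α k₁ : ℝ) : ℝ :=
  2 ^ (α - 1) / (4 * k₁) * ∑' T : ℕ, lambdaTerm K d α k₁ (T + 1)

end ECAPE

end

/-!
The empirical means are compared with the true ones through two confidence regions per arm: a box
of half-width `β_i` and a ball whose squared radius is `2 σ_u² g / N_i`. A snapshot is `Accurate` if
every arm lies strictly within both. Everything about the algorithm is deterministic on accurate
snapshots, and probability enters only through a union bound.

*Correctness.* On an accurate snapshot every feasible arm belongs to `F_t ∪ G_t`, the arms of `O_t`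
with `γ ≥ 0` are truly feasible, and `Z_2 ≥ 0` makes every arm of `(F_t ∪ G_t) \ O_t` strictly
dominated by an arm of `O_t` (`Accurate.exists_dominator`). Hence a stop returns a valid answer
(`Accurate.isCorrect_of_stops`).

*Sampling.* Fix any valid answer `(S, I)` of finite complexity. On an accurate snapshot at which the
algorithm does not stop, the leader `b` or the challenger `c` is under-explored relative to its own
term of `C(ν, S, I)` (`Accurate.exists_underexplored`). Both arms lie in `F_t ∪ G_t`, so an arm of
`I`, or an arm of `O*` with `γ < 0`, has a small margin `η`. Otherwise both lie in `O* ∪ S`, and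
either `b ∈ S` is not confidently dominated by the arm that comes closest to dominating it, or
`b ∈ O*` is almost dominated by `c`. In both cases the triangle inequality for `m` bounds both gaps
`Δ_b` and `Δ_c` by `2 (β_b + β_c)`, and the less explored arm has `Δ ≤ 4 β`.

*Counting.* A pull of an arm with `N ≤ B` happens at most `B` times. If the snapshots of the rounds
between `T / 2` and `T` are accurate and `T < τ`, this gives `T ≤ 2 (16 f(T, δ) C + H)`
(`le_of_lt_stopTime`), which is false beyond the announced time (`add_one_lt_of_le`).

*Probability.* The Chernoff bound for sums of independent subGaussian variables, together with a
`1/2`-net of at most `5 ^ d` unit vectors, bounds the probability that one empirical mean leaves its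
regions (`tableLaw_roundDeviation_le`). For `δ`-correctness the mean of `n` observations is tested
against the thresholds of round `n`, and the sum of `n ^ (-α)` is at most `1 + 1 / (α - 1) < k₁`. For
the expectation, the regions of level `1` and round `⌈T / 2⌉` fail for some `n ≤ T` with a
probability below the term of index `T` in the series for `Λ_α` (`tableLaw_badEvent_le`), and
`τ` is the sum over `T` of the indicators of `T < τ`.
-/

namespace ECAPE

/-! ### Pareto geometry -/

section Geometry

variable {d : ℕ}

lemma smallM_le (x y : Vec d) (c : Fin d) : smallM x y ≤ y c - x c :=
  ciInf_le (Set.finite_range _).bddBelow c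

lemma le_smallM [NeZero d] {x y : Vec d} {a : ℝ} (h : ∀ c, a ≤ y c - x c) : a ≤ smallM x y :=
  le_ciInf h

/-- This reduces every statement about `M` to one about `m`. -/
lemma bigM_eq_neg_smallM [NeZero d] (x y : Vec d) : bigM x y = -smallM x y := by
  refine le_antisymm (ciSup_le fun c => by linarith [smallM_le x y c]) ?_
  rw [neg_le]
  refine le_smallM fun c => ?_
  have : x c - y c ≤ bigM x y :=
    le_ciSup (f := fun c => x c - y c) (Set.finite_range _).bddAbove c
  linarith

lemma smallM_self (x : Vec d) : smallM x x = 0 := by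
  simp [smallM]

lemma dominated_iff [NeZero d] {x y : Vec d} : Dominated x y ↔ 0 ≤ smallM x y :=
  ⟨fun h => le_smallM fun c => sub_nonneg.2 (h c),
    fun h c => sub_nonneg.1 (h.trans (smallM_le x y c))⟩

lemma smallM_triangle [NeZero d] (x y z : Vec d) : smallM x y + smallM y z ≤ smallM x z :=
  le_smallM fun c => by linarith [smallM_le x y c, smallM_le y z c]

lemma smallM_add_smallM_comm [NeZero d] (x y : Vec d) : smallM x y + smallM y x ≤ 0 :=
  (smallM_triangle x y x).trans (smallM_self x).le

lemma smallM_lt_add [NeZero d] {x x' y y' : Vec d} {a b : ℝ} (hx : ∀ c, |x c - x' c| < a)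
    (hy : ∀ c, |y c - y' c| < b) : smallM x y < smallM x' y' + (a + b) := by
  obtain ⟨c, hc⟩ := exists_eq_ciInf_of_finite (f := fun c => y' c - x' c)
  have h1 := smallM_le x y c
  have h2 := abs_lt.1 (hx c)
  have h3 := abs_lt.1 (hy c)
  have h4 : smallM x' y' = y' c - x' c := hc.symm
  linarith [h2.1, h3.2]

lemma eta_le_eta_add_edist (P : Set (Vec d)) (x y : Vec d) : eta P x ≤ eta P y + edist x y := by
  unfold eta
  split_ifs with hx hy hy
  · exact Metric.infEDist_le_infEDist_add_edist
  · exact (Metric.infEDist_le_edist_of_mem (s := Pᶜ) hy).trans le_add_self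
  · exact (Metric.infEDist_le_edist_of_mem (s := P) hy).trans le_add_self
  · exact Metric.infEDist_le_infEDist_add_edist

lemma eta_le_edist_of_mem_of_notMem {P : Set (Vec d)} {x y : Vec d} (hx : x ∈ P) (hy : y ∉ P) :
    eta P x ≤ edist x y := by
  rw [eta, if_pos hx]
  exact Metric.infEDist_le_edist_of_mem (s := Pᶜ) hy

lemma eta_le_edist_of_notMem_of_mem {P : Set (Vec d)} {x y : Vec d} (hx : x ∉ P) (hy : y ∈ P) :
    eta P x ≤ edist x y := by
  rw [eta, if_neg hx]
  exact Metric.infEDist_le_edist_of_mem hy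

end Geometry

lemma exists_le_of_le_biSup {ι : Type*} [Finite ι] {T : Set ι} {u : ι → EReal} {a : EReal}
    (ha : ⊥ < a) (h : a ≤ ⨆ j ∈ T, u j) : ∃ j ∈ T, a ≤ u j := by
  obtain rfl | hT := T.eq_empty_or_nonempty
  · simp [ha.ne'] at h
  · obtain ⟨j, hj, hmax⟩ := Set.exists_max_image T u T.toFinite hT
    exact ⟨j, hj, h.trans (iSup₂_le hmax)⟩

lemma exists_of_biInf_lt {ι : Type*} {T : Set ι} {u : ι → EReal} {a : EReal}
    (h : ⨅ j ∈ T, u j < a) : ∃ j ∈ T, u j < a := by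
  simpa only [iInf_lt_iff, exists_prop] using h

/-! ### Accurate snapshots -/

section Accuracy

variable {K d : ℕ}

/-- The radius of the confidence ball of arm `i`: the arm has `γ_i < 0` exactly when its empirical
mean is closer than this to the boundary of the feasible region. -/
noncomputable def radius (p : Input d) (s : Snapshot K d) (i : Fin K) : ℝ :=
  √(2 * p.σu ^ 2 * p.g s.t / s.n i)

/-- The snapshot `s` is accurate for the means `y`: every arm has been pulled, and every empirical
mean is strictly within both of its confidence regions. -/
def Accurate (p : Input d) (s : Snapshot K d) (y : Fin K → Vec d) : Prop :=
  ∀ i, 0 < s.n i ∧ (∀ c, |s.y i c - y i c| < beta p s i) ∧ ‖s.y i - y i‖ < radius p s i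

variable {p : Input d} {s : Snapshot K d} {y : Fin K → Vec d}

lemma gam_neg_iff (hσ : 0 < p.σu) {i : Fin K} (hn : 0 < s.n i) (hr : 0 < radius p s i) :
    gam p s i < 0 ↔ eta p.P (s.y i) < ENNReal.ofReal (radius p s i) := by
  have hn' : (0 : ℝ) < s.n i := by exact_mod_cast hn
  have hq : 0 < 2 * p.σu ^ 2 * p.g s.t / s.n i := Real.sqrt_pos.1 hr
  have hrr : radius p s i ^ 2 = 2 * p.σu ^ 2 * p.g s.t / s.n i := Real.sq_sqrt hq.le
  have hk : 0 < s.n i / (2 * p.σu ^ 2) := by positivity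
  unfold gam
  by_cases ht : eta p.P (s.y i) = ⊤
  · rw [ht]
    simp [hk, ENNReal.mul_top]
  · obtain ⟨e, he0, he⟩ : ∃ e : ℝ, 0 ≤ e ∧ eta p.P (s.y i) = ENNReal.ofReal e :=
      ⟨_, ENNReal.toReal_nonneg, (ENNReal.ofReal_toReal ht).symm⟩
    rw [he, ← ENNReal.ofReal_pow he0, ← ENNReal.ofReal_mul hk.le, EReal.coe_ennreal_ofReal,
      max_eq_left (by positivity), ← EReal.coe_sub, ← EReal.coe_zero, EReal.coe_lt_coe_iff,
      ENNReal.ofReal_lt_ofReal_iff hr, ← pow_lt_pow_iff_left₀ he0 hr.le two_ne_zero, hrr,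
      sub_neg, lt_div_iff₀ hn', div_mul_eq_mul_div, div_lt_iff₀ (by positivity)]
    constructor <;> intro h <;> linarith

lemma Accurate.edist_lt (h : Accurate p s y) (i : Fin K) :
    edist (s.y i) (y i) < ENNReal.ofReal (radius p s i) := by
  rw [edist_dist, dist_eq_norm]
  exact (ENNReal.ofReal_lt_ofReal_iff ((norm_nonneg _).trans_lt (h i).2.2)).2 (h i).2.2

lemma Accurate.radius_pos (h : Accurate p s y) (i : Fin K) : 0 < radius p s i :=
  (norm_nonneg _).trans_lt (h i).2.2

lemma Accurate.smallM_lt [NeZero d] (h : Accurate p s y) (i j : Fin K) :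
    smallM (y i) (y j) < smallM (s.y i) (s.y j) + (beta p s i + beta p s j) :=
  smallM_lt_add (fun c => by rw [abs_sub_comm]; exact (h i).2.1 c)
    (fun c => by rw [abs_sub_comm]; exact (h j).2.1 c)

lemma Accurate.smallMHat_lt [NeZero d] (h : Accurate p s y) (i j : Fin K) :
    smallM (s.y i) (s.y j) < smallM (y i) (y j) + (beta p s i + beta p s j) :=
  smallM_lt_add (h i).2.1 (h j).2.1

lemma Accurate.beta_pos [NeZero d] (h : Accurate p s y) (i : Fin K) : 0 < beta p s i :=
  (abs_nonneg _).trans_lt ((h i).2.1 0)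

/-- An arm on the wrong side of the boundary is not confidently so. -/
lemma Accurate.gam_neg_of_not_mem_iff (hσ : 0 < p.σu) (h : Accurate p s y) {i : Fin K}
    (hi : ¬ (s.y i ∈ p.P ↔ y i ∈ p.P)) : gam p s i < 0 := by
  refine (gam_neg_iff hσ (h i).1 (h.radius_pos i)).2 (lt_of_le_of_lt ?_ (h.edist_lt i))
  by_cases hs : s.y i ∈ p.P
  · exact eta_le_edist_of_mem_of_notMem hs (by tauto)
  · exact eta_le_edist_of_notMem_of_mem hs (by tauto)

lemma Accurate.feasible_subset (hσ : 0 < p.σu) (h : Accurate p s y) :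
    feasible p.P y ⊆ setF p s ∪ setG p s := by
  intro i hi
  by_cases hs : s.y i ∈ p.P
  · exact Or.inl hs
  · exact Or.inr ⟨hs, h.gam_neg_of_not_mem_iff hσ (fun e => hs (e.2 hi))⟩

lemma Accurate.eta_lt_of_gam_neg (hσ : 0 < p.σu) (h : Accurate p s y) {i : Fin K}
    (hi : gam p s i < 0) : eta p.P (y i) < ENNReal.ofReal (2 * radius p s i) := by
  have h1 := (gam_neg_iff hσ (h i).1 (h.radius_pos i)).1 hi
  have h2 := h.edist_lt i
  rw [two_mul, ENNReal.ofReal_add (h.radius_pos i).le (h.radius_pos i).le]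
  refine (eta_le_eta_add_edist p.P (y i) (s.y i)).trans_lt ?_
  rw [edist_comm]
  exact ENNReal.add_lt_add h1 h2

lemma exists_of_xi_nonneg {i : Fin K} (h : 0 ≤ xi p s i) :
    ∃ j ∈ setF p s ∪ setG p s, j ≠ i ∧ beta p s i + beta p s j ≤ smallM (s.y i) (s.y j) := by
  obtain ⟨j, ⟨hj, hji⟩, hle⟩ := exists_le_of_le_biSup (by simp) h
  rw [← EReal.coe_zero, EReal.coe_le_coe_iff] at hle
  unfold smallMLow at hle
  exact ⟨j, hj, hji, by linarith⟩

lemma lt_beta_add_beta_of_xi_neg {i j : Fin K} (h : xi p s i < 0)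
    (hj : j ∈ setF p s ∪ setG p s) (hji : j ≠ i) :
    smallM (s.y i) (s.y j) < beta p s i + beta p s j := by
  have h1 : ((smallMLow p s i j : ℝ) : EReal) ≤ xi p s i :=
    le_iSup₂_of_le (f := fun j (_ : j ∈ (setF p s ∪ setG p s) \ {i}) =>
      ((smallMLow p s i j : ℝ) : EReal)) j ⟨hj, hji⟩ le_rfl
  have h2 := h1.trans_lt h
  rw [← EReal.coe_zero, EReal.coe_lt_coe_iff] at h2
  unfold smallMLow at h2
  linarith

lemma setO_subset : setO p s ⊆ setF p s := fun _ h => h.1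

end Accuracy

/-! ### Correctness of the recommendation -/

section Correctness

variable {K d : ℕ} {p : Input d} {s : Snapshot K d} {y : Fin K → Vec d}

lemma isPartition_recommend (p : Input d) (s : Snapshot K d) : IsPartition (recommend p s) := by
  have hO : setO p s ⊆ setF p s := setO_subset
  refine ⟨Set.eq_univ_of_forall fun i => ?_, ?_, ?_, ?_⟩
  · simp only [recommend, Set.mem_union, Set.mem_sdiff, Set.mem_inter_iff, Set.mem_compl_iff]
    tauto
  · exact Set.disjoint_left.2 fun i h h' => h'.2 h
  · exact Set.disjoint_left.2 fun i h h' => h'.1 (hO h)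
  · exact Set.disjoint_left.2 fun i h h' => h.1.elim h'.1 h'.2

/-- When `Z_2 ≥ 0`, an arm of `F_t ∪ G_t` outside of `O_t` is confidently dominated by another arm
of `F_t ∪ G_t`. -/
lemma exists_of_Z2_nonneg (hZ : 0 ≤ Z2 p s) {i : Fin K} (hi : i ∈ setF p s ∪ setG p s)
    (hiO : i ∉ setO p s) :
    ∃ j ∈ setF p s ∪ setG p s, j ≠ i ∧ beta p s i + beta p s j ≤ smallM (s.y i) (s.y j) := by
  have hz : 0 ≤ z2Term p s i := hZ.trans (iInf₂_le i hiO)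
  refine exists_of_xi_nonneg ?_
  by_cases hF : i ∈ setF p s
  · rwa [z2Term, if_pos hF] at hz
  · rw [z2Term, if_neg hF] at hz
    exact (le_max_iff.1 hz).resolve_left (hi.resolve_left hF).2.not_ge

/-- When `Z_2 ≥ 0` and the snapshot is accurate, following the chain of confident dominations
leads from any arm of `F_t ∪ G_t` outside of `O_t` to a true dominator in `O_t`. -/
lemma Accurate.exists_dominator [NeZero d] (h : Accurate p s y) (hZ : 0 ≤ Z2 p s) {i : Fin K}
    (hi : i ∈ setF p s ∪ setG p s) (hiO : i ∉ setO p s) :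
    ∃ j ∈ setO p s, 0 < smallM (y i) (y j) := by
  -- among the dominators of `i`, the one with the largest margin has no dominator of its own
  let T : Set (Fin K) := {j | j ∈ setF p s ∪ setG p s ∧ 0 < smallM (y i) (y j)}
  have step : ∀ k ∈ setF p s ∪ setG p s, k ∉ setO p s →
      ∃ j ∈ setF p s ∪ setG p s, 0 < smallM (y k) (y j) := by
    intro k hk hkO
    obtain ⟨j, hj, -, hle⟩ := exists_of_Z2_nonneg hZ hk hkO
    exact ⟨j, hj, by linarith [h.smallMHat_lt k j]⟩
  obtain ⟨j₀, hj₀⟩ : T.Nonempty := step i hi hiO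
  obtain ⟨j, hjT, hmax⟩ := Set.exists_max_image T (fun j => smallM (y i) (y j)) T.toFinite ⟨j₀, hj₀⟩
  refine ⟨j, ?_, hjT.2⟩
  by_contra hjO
  obtain ⟨k, hk, hjk⟩ := step j hjT.1 hjO
  have htri := smallM_triangle (y i) (y j) (y k)
  have := hmax k ⟨hk, by linarith [hjT.2]⟩
  linarith

theorem Accurate.isCorrect_of_stops [NeZero d] (hσ : 0 < p.σu) (h : Accurate p s y)
    (hs : Stops p s) : IsCorrect p.P y (recommend p s) := by
  obtain ⟨hZ1, hZ2⟩ := hs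
  have hsub := h.feasible_subset hσ
  have hOF : setO p s ⊆ feasible p.P y := by
    intro i hi
    by_contra hiF
    have h1 : 0 ≤ gam p s i := (hZ1.trans (min_le_left _ _)).trans (iInf₂_le i hi)
    exact h1.not_gt (h.gam_neg_of_not_mem_iff hσ fun e => hiF (e.1 (setO_subset hi)))
  have hOO : ∀ i ∈ setO p s, ∀ j ∈ setO p s, j ≠ i → smallM (y i) (y j) < 0 := by
    intro i hi j hj hji
    have h1 : 0 ≤ psTerm p s i := (hZ1.trans (min_le_right _ _)).trans (iInf₂_le i hi)
    have h2 : (0 : EReal) ≤ ((bigMLow p s i j : ℝ) : EReal) := h1.trans (iInf₂_le j ⟨hj, hji⟩)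
    rw [← EReal.coe_zero, EReal.coe_le_coe_iff] at h2
    unfold bigMLow at h2
    rw [bigM_eq_neg_smallM] at h2
    linarith [h.smallM_lt i j]
  have hO : setO p s = optSet p.P y := by
    ext i
    refine ⟨fun hi => ⟨hOF hi, fun j hj hji hdom => ?_⟩, fun hi => ?_⟩
    · rw [dominated_iff] at hdom
      by_cases hjO : j ∈ setO p s
      · exact (hOO i hi j hjO hji).not_ge hdom
      · obtain ⟨k, hk, hjk⟩ := h.exists_dominator hZ2 (hsub hj) hjO
        have hik : 0 < smallM (y i) (y k) := by linarith [smallM_triangle (y i) (y j) (y k)]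
        have hki : k ≠ i := by
          rintro rfl
          exact hik.ne' (smallM_self _)
        exact (hOO i hi k hk hki).not_gt hik
    · by_contra hiO
      obtain ⟨k, hk, hik⟩ := h.exists_dominator hZ2 (hsub hi.1) hiO
      have hki : k ≠ i := by
        rintro rfl
        exact hik.ne' (smallM_self _)
      exact hi.2 k (hOF hk) hki (dominated_iff.2 hik.le)
  refine ⟨hO, ?_, ?_, ?_, ?_⟩
  · rintro i ⟨hi, hiO⟩
    obtain ⟨k, hk, hik⟩ := h.exists_dominator hZ2 hi hiO
    refine ⟨k, hOF hk, ?_, dominated_iff.2 hik.le⟩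
    rintro rfl
    exact hiO hk
  · rintro i ⟨hiF, hiG⟩ hi
    exact (hsub hi).elim hiF hiG
  · exact (isPartition_recommend p s).2.2.2.inter_eq
  · change ((setF p s ∪ setG p s) \ setO p s) ∪ ((setF p s)ᶜ ∩ (setG p s)ᶜ) = (optSet p.P y)ᶜ
    rw [← hO]
    ext i
    have := @setO_subset _ _ p s i
    simp only [Set.mem_union, Set.mem_sdiff, Set.mem_inter_iff, Set.mem_compl_iff]
    tauto

end Correctness

/-! ### Under-explored arms -/

section Sampling

variable {K d : ℕ} {p : Input d} {s : Snapshot K d} {y : Fin K → Vec d} {S I : Set (Fin K)}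

section Valid

variable {P : Set (Vec d)}

lemma optSet_disjoint_of_valid (hv : (S, I) ∈ validAnswers P y) {i : Fin K} (hi : i ∈ S) :
    i ∉ optSet P y := by
  have : i ∈ S ∪ I := Or.inl hi
  rw [hv.2.2.2] at this
  exact this

lemma mem_cases_of_valid (hv : (S, I) ∈ validAnswers P y) (i : Fin K) :
    i ∈ optSet P y ∨ i ∈ S ∨ i ∈ I := by
  by_cases hi : i ∈ optSet P y
  · exact Or.inl hi
  · have : i ∈ (optSet P y)ᶜ := hi
    rw [← hv.2.2.2] at this
    exact Or.inr this

/-- Adding the arms of `S`, all of them suboptimal, to `O*` leaves the Pareto set unchanged. -/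
lemma pareto_optSet_union (hv : (S, I) ∈ validAnswers P y) :
    pareto (optSet P y ∪ S) y = optSet P y := by
  ext i
  refine ⟨fun hi => ?_, fun hi => ⟨Or.inl hi, fun j hj hji hdom => ?_⟩⟩
  · refine hi.1.resolve_right fun hiS => ?_
    obtain ⟨j, hjF, hji, hdom⟩ := hv.1 hiS
    refine hi.2 j ?_ hji hdom
    exact (mem_cases_of_valid hv j).imp_right fun h => h.resolve_right fun hI => hv.2.1 hI hjF
  · by_cases hjF : j ∈ feasible P y
    · exact hi.2 j hjF hji hdom
    · obtain ⟨k, hkF, -, hjk⟩ := hv.1 (hj.resolve_left fun h => hjF h.1)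
      have hik : Dominated (y i) (y k) := fun c => (hdom c).trans (hjk c)
      by_cases hki : k = i
      · -- `j` would have the mean of the feasible arm `i`
        subst hki
        have : y k = y j := by ext c; exact le_antisymm (hdom c) (hjk c)
        exact hjF (show y j ∈ P from this ▸ hkF)
      · exact hi.2 k hkF hki hik

lemma gap_of_mem_optSet (hv : (S, I) ∈ validAnswers P y) {i : Fin K} (hi : i ∈ optSet P y) :
    gap (optSet P y ∪ S) y i
      = min (gapPlus (optSet P y ∪ S) y i) (gapMinus (optSet P y ∪ S) y i) := by
  rw [gap, if_pos (by rwa [pareto_optSet_union hv])]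

lemma gap_of_mem_right (hv : (S, I) ∈ validAnswers P y) {i : Fin K} (hi : i ∈ S) :
    gap (optSet P y ∪ S) y i = ⨆ j ∈ optSet P y, ((smallM (y i) (y j) : ℝ) : EReal) := by
  rw [gap, if_neg (by rw [pareto_optSet_union hv]; exact optSet_disjoint_of_valid hv hi), subGap,
    pareto_optSet_union hv]

lemma gap_le_of_optSet [NeZero d] (hv : (S, I) ∈ validAnswers P y) {i j : Fin K}
    (hi : i ∈ optSet P y) (hj : j ∈ optSet P y) (hji : j ≠ i) {w : ℝ}
    (hw : -smallM (y i) (y j) ≤ w ∨ -smallM (y j) (y i) ≤ w) :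
    gap (optSet P y ∪ S) y i ≤ w := by
  rw [gap_of_mem_optSet hv hi]
  have hjP : j ∈ pareto (optSet P y ∪ S) y := by rwa [pareto_optSet_union hv]
  refine (min_le_left _ _).trans ((iInf₂_le j ⟨hjP, hji⟩).trans ?_)
  rw [EReal.coe_le_coe_iff, bigM_eq_neg_smallM, bigM_eq_neg_smallM]
  exact min_le_iff.2 hw

lemma gap_le_of_suboptimal [NeZero d] (hv : (S, I) ∈ validAnswers P y) {i j : Fin K}
    (hi : i ∈ optSet P y) (hj : j ∈ S) {w D : ℝ}
    (hD : gap (optSet P y ∪ S) y j ≤ D) (hw : max (-smallM (y j) (y i)) 0 + D ≤ w) :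
    gap (optSet P y ∪ S) y i ≤ w := by
  have hjO := optSet_disjoint_of_valid hv hj
  rw [gap_of_mem_optSet hv hi]
  have hjP : j ∉ pareto (optSet P y ∪ S) y := by rwa [pareto_optSet_union hv]
  refine (min_le_right _ _).trans ((iInf₂_le j ⟨Or.inr hj, hjP⟩).trans ?_)
  rw [gap, if_neg hjP] at hD
  rw [bigM_eq_neg_smallM]
  refine (add_le_add_right hD _).trans ?_
  rw [← EReal.coe_add, EReal.coe_le_coe_iff]
  exact hw

/-- Both gaps are at most `w` if the gap of the suboptimal leader `b` is, and if the challenger `c`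
comes within `w` of dominating `b` by that gap. -/
lemma gap_le_of_suboptimal_leader [NeZero d] (hv : (S, I) ∈ validAnswers P y) {b c : Fin K}
    (hb : b ∈ S) (hc : c ∈ optSet P y ∪ S) {w D : ℝ}
    (hD : gap (optSet P y ∪ S) y b ≤ D) (hDw : D ≤ w) (hDc : D - smallM (y b) (y c) ≤ w) :
    gap (optSet P y ∪ S) y b ≤ w ∧ gap (optSet P y ∪ S) y c ≤ w := by
  refine ⟨hD.trans (by exact_mod_cast hDw), ?_⟩
  obtain hc | hc := hc
  · refine gap_le_of_suboptimal hv hc hb hD ?_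
    rw [← max_add_add_right, max_le_iff]
    constructor <;> linarith
  · rw [gap_of_mem_right hv hc]
    refine iSup₂_le fun j hj => ?_
    rw [gap_of_mem_right hv hb] at hD
    have h1 : smallM (y b) (y j) ≤ D :=
      EReal.coe_le_coe_iff.1 ((le_iSup₂_of_le (f := fun j (_ : j ∈ optSet P y) =>
        ((smallM (y b) (y j) : ℝ) : EReal)) j hj le_rfl).trans hD)
    rw [EReal.coe_le_coe_iff]
    linarith [smallM_triangle (y b) (y c) (y j)]

/-- Both gaps are small if the challenger `c` almost dominates an optimal leader `b`. -/
lemma gap_le_of_optimal_leader [NeZero d] (hv : (S, I) ∈ validAnswers P y) {b c : Fin K}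
    (hgap : ∀ i ∈ S, 0 < gap (optSet P y ∪ S) y i)
    (hb : b ∈ optSet P y) (hc : c ∈ optSet P y ∪ S) (hcb : c ≠ b) {w : ℝ}
    (hw : -smallM (y b) (y c) ≤ w) :
    gap (optSet P y ∪ S) y b ≤ w ∧ gap (optSet P y ∪ S) y c ≤ w := by
  obtain hc | hc := hc
  · exact ⟨gap_le_of_optSet hv hb hc hcb (Or.inl hw),
      gap_le_of_optSet hv hc hb hcb.symm (Or.inr hw)⟩
  -- `j` is the optimal arm that realizes the gap of `c`
  obtain ⟨j, hj, hmax⟩ := Set.exists_max_image (optSet P y) (fun j => smallM (y c) (y j))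
    (Set.toFinite _) ⟨b, hb⟩
  have hgc : gap (optSet P y ∪ S) y c ≤ ((smallM (y c) (y j) : ℝ) : EReal) := by
    rw [gap_of_mem_right hv hc]
    exact iSup₂_le fun k hk => EReal.coe_le_coe_iff.2 (hmax k hk)
  have hpos : 0 < smallM (y c) (y j) := by exact_mod_cast (hgap c hc).trans_le hgc
  by_cases hjb : j = b
  · subst hjb
    have h1 : smallM (y c) (y j) ≤ w := by linarith [smallM_add_smallM_comm (y j) (y c)]
    refine ⟨gap_le_of_suboptimal hv hb hc hgc ?_, hgc.trans (by exact_mod_cast h1)⟩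
    rw [← max_add_add_right, max_le_iff]
    constructor <;> linarith
  · have hbj : smallM (y b) (y j) < 0 := by
      by_contra! hcon
      exact hb.2 j hj.1 hjb (dominated_iff.2 hcon)
    have htri := smallM_triangle (y b) (y c) (y j)
    refine ⟨gap_le_of_optSet hv hb hj hjb (Or.inl (by linarith)), hgc.trans ?_⟩
    rw [EReal.coe_le_coe_iff]
    linarith

end Valid

lemma le_ofReal_mul_div_sq {k q r n : ℝ} {g : ℝ≥0∞} (hq : 0 < q) (hr : 0 < r)
    (hn : 0 ≤ n) (hg : g ≤ ENNReal.ofReal r) (hkq : n * r ^ 2 ≤ k * q) :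
    ENNReal.ofReal n ≤ ENNReal.ofReal k * (ENNReal.ofReal q / g ^ 2) := by
  have hk : 0 ≤ k := by
    by_contra! hk
    nlinarith [mul_pos_of_neg_of_neg hk (neg_lt_zero.2 hq), mul_nonneg hn (sq_nonneg r)]
  calc ENNReal.ofReal n ≤ ENNReal.ofReal (k * (q / r ^ 2)) := by
        refine ENNReal.ofReal_le_ofReal ?_
        rw [← mul_div_assoc, le_div_iff₀ (by positivity)]
        exact hkq
    _ = ENNReal.ofReal k * (ENNReal.ofReal q / ENNReal.ofReal r ^ 2) := by
        rw [ENNReal.ofReal_mul hk, ENNReal.ofReal_div_of_pos (by positivity),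
          ENNReal.ofReal_pow hr.le]
    _ ≤ _ := by gcongr

lemma Accurate.le_gapCost [NeZero d] (h : Accurate p s y) (hσ : 0 < p.σ) {T : Set (Fin K)}
    {i : Fin K} (hg : gap T y i ≤ ((4 * beta p s i : ℝ) : EReal)) :
    (s.n i : ℝ≥0∞) ≤ ENNReal.ofReal (16 * p.f s.t) * gapCost p.σ T y i := by
  have hb := h.beta_pos i
  have hn : (0 : ℝ) < s.n i := by exact_mod_cast (h i).1
  have hsq : beta p s i ^ 2 = 2 * p.σ ^ 2 * p.f s.t / s.n i := Real.sq_sqrt (Real.sqrt_pos.1 hb).le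
  rw [← ENNReal.ofReal_natCast]
  refine le_ofReal_mul_div_sq (r := 4 * beta p s i) (by positivity) (by positivity) hn.le ?_ ?_
  · exact EReal.toENNReal_le_toENNReal hg
  · rw [mul_pow, hsq]
    field_simp
    linarith

lemma Accurate.le_feasCost (h : Accurate p s y) (hσ : 0 < p.σu)
    {i : Fin K} (hi : gam p s i < 0) :
    (s.n i : ℝ≥0∞) ≤ ENNReal.ofReal (4 * p.g s.t) * feasCost p.σu p.P (y i) := by
  have hb := h.radius_pos i
  have hn : (0 : ℝ) < s.n i := by exact_mod_cast (h i).1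
  have hsq : radius p s i ^ 2 = 2 * p.σu ^ 2 * p.g s.t / s.n i :=
    Real.sq_sqrt (Real.sqrt_pos.1 hb).le
  rw [← ENNReal.ofReal_natCast]
  refine le_ofReal_mul_div_sq (r := 2 * radius p s i) (by positivity) (by positivity) hn.le
    (h.eta_lt_of_gam_neg hσ hi).le ?_
  rw [mul_pow, hsq]
  field_simp
  linarith

/-- As long as the algorithm has not stopped, the leader or the challenger is under-explored
relative to its cost in *every* valid answer `(S, I)`. -/
theorem Accurate.exists_underexplored [NeZero d] (h : Accurate p s y) (hσ : 0 < p.σ)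
    (hσu : 0 < p.σu) (hv : (S, I) ∈ validAnswers p.P y)
    (hgap : ∀ i ∈ S, 0 < gap (optSet p.P y ∪ S) y i) (hs : ¬ Stops p s) {b c : Fin K}
    (hb : IsLeader p s b) (hc : IsChallenger p s b c) :
    ∃ a, (b = a ∨ c = a) ∧
      ((a ∈ optSet p.P y ∪ S ∧
        (s.n a : ℝ≥0∞) ≤ ENNReal.ofReal (16 * p.f s.t) * gapCost p.σ (optSet p.P y ∪ S) y a) ∨
      (a ∈ optSet p.P y ∪ I ∧
        (s.n a : ℝ≥0∞) ≤ ENNReal.ofReal (4 * p.g s.t) * feasCost p.σu p.P (y a))) := by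
  by_contra! hcon
  have hgood : ∀ a, (b = a ∨ c = a) → a ∈ optSet p.P y ∪ S →
      ¬ gap (optSet p.P y ∪ S) y a ≤ ((4 * beta p s a : ℝ) : EReal) := fun a ha haS hle =>
    ((hcon a ha).1 haS).not_ge (h.le_gapCost hσ hle)
  have hgam : ∀ a, (b = a ∨ c = a) → gam p s a < 0 → a ∉ optSet p.P y ∪ I := fun a ha hneg haI =>
    ((hcon a ha).2 haI).not_ge (h.le_feasCost hσu hneg)
  have hβb := h.beta_pos b
  have hβc := h.beta_pos c
  have hnotI : ∀ a, (b = a ∨ c = a) → a ∈ setF p s ∪ setG p s → a ∉ I := by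
    intro a ha haA haI
    refine hgam a ha ?_ (Or.inr haI)
    obtain haF | haG := haA
    · exact h.gam_neg_of_not_mem_iff hσu fun e => hv.2.1 haI (e.1 haF)
    · exact haG.2
  have hOS : ∀ a, (b = a ∨ c = a) → a ∈ setF p s ∪ setG p s → a ∈ optSet p.P y ∪ S :=
    fun a ha haA => (mem_cases_of_valid hv a).imp_right fun e => e.resolve_right (hnotI a ha haA)
  -- the less explored of the two arms has the larger bonus
  have hclose : b ∈ optSet p.P y ∪ S → c ∈ optSet p.P y ∪ S →
      ¬ (gap (optSet p.P y ∪ S) y b ≤ ((2 * (beta p s b + beta p s c) : ℝ) : EReal) ∧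
        gap (optSet p.P y ∪ S) y c ≤ ((2 * (beta p s b + beta p s c) : ℝ) : EReal)) := by
    rintro hbm hcm ⟨h1, h2⟩
    obtain hle | hle := le_total (beta p s b) (beta p s c)
    · exact hgood c (Or.inr rfl) hcm (h2.trans (EReal.coe_le_coe_iff.2 (by linarith)))
    · exact hgood b (Or.inl rfl) hbm (h1.trans (EReal.coe_le_coe_iff.2 (by linarith)))
  have hchal : ∀ j ∈ setF p s ∪ setG p s, j ≠ b →
      c ∈ setF p s ∪ setG p s ∧ c ≠ b ∧ ∀ k ∈ setF p s ∪ setG p s, k ≠ b →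
        smallM (s.y b) (s.y k) + beta p s k ≤ smallM (s.y b) (s.y c) + beta p s c := by
    intro j hj hjb
    obtain ⟨⟨hcA, hcb⟩, hmin⟩ := hc.1 ⟨j, hj, hjb⟩
    refine ⟨hcA, hcb, fun k hk hkb => ?_⟩
    have h1 := EReal.coe_le_coe_iff.1 (hmin k ⟨hk, hkb⟩)
    unfold bigMLow at h1
    rw [bigM_eq_neg_smallM, bigM_eq_neg_smallM] at h1
    linarith
  have hsuper := h.feasible_subset hσu
  have hsub : b ∈ S → ¬ (c ∈ setF p s ∪ setG p s → c ≠ b →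
      smallM (s.y b) (s.y c) < beta p s b + beta p s c) := by
    intro hbS hlt
    have hbO := optSet_disjoint_of_valid hv hbS
    obtain hO | hO := (optSet p.P y).eq_empty_or_nonempty
    · refine hgood b (Or.inl rfl) (Or.inr hbS) ?_
      rw [gap_of_mem_right hv hbS, hO]
      simp
    obtain ⟨j, hj, hmax⟩ := Set.exists_max_image (optSet p.P y)
      (fun j => smallM (y b) (y j)) (Set.toFinite _) hO
    have hjb : j ≠ b := fun e => hbO (e ▸ hj)
    obtain ⟨hcA, hcb, hcmax⟩ := hchal j (hsuper hj.1) hjb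
    have hcj := hcmax j (hsuper hj.1) hjb
    have hcOS := hOS c (Or.inr rfl) hcA
    have h1 := hlt hcA hcb
    have h2 := h.smallM_lt b j
    have h3 := h.smallMHat_lt b c
    refine hclose (Or.inr hbS) hcOS
      (gap_le_of_suboptimal_leader hv hbS hcOS (D := smallM (y b) (y j)) ?_ ?_ ?_)
    · rw [gap_of_mem_right hv hbS]
      exact iSup₂_le fun k hk => EReal.coe_le_coe_iff.2 (hmax k hk)
    · linarith
    · linarith
  have hopt : b ∈ optSet p.P y → c ∈ setF p s ∪ setG p s → c ≠ b →
      ¬ -smallM (y b) (y c) ≤ 2 * (beta p s b + beta p s c) := by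
    intro hbO hcA hcb hle
    have hcOS := hOS c (Or.inr rfl) hcA
    exact hclose (Or.inl hbO) hcOS (gap_le_of_optimal_leader hv hgap hbO hcOS hcb hle)
  obtain hZ2 | hZ2 := lt_or_ge (Z2 p s) 0
  · obtain ⟨hbO, hbmin⟩ := hb.1 hZ2
    obtain ⟨i, hiO, hi⟩ := exists_of_biInf_lt hZ2
    have hzb : z2Term p s b < 0 := (hbmin i hiO).trans_lt hi
    have hb2 : b ∈ setF p s ∪ setG p s ∧ xi p s b < 0 := by
      by_cases hbF : b ∈ setF p s
      · rw [z2Term, if_pos hbF] at hzb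
        exact ⟨Or.inl hbF, hzb⟩
      · rw [z2Term, if_neg hbF, max_lt_iff] at hzb
        exact ⟨Or.inr ⟨hbF, hzb.1⟩, hzb.2⟩
    obtain hbO' | hbS := hOS b (Or.inl rfl) hb2.1
    · have hbF : b ∈ setF p s := hb2.1.resolve_right fun hG =>
        hgam b (Or.inl rfl) hG.2 (Or.inl hbO')
      -- the optimal leader is empirically dominated by some `j`, hence almost so by `c`
      have : ∃ j ∈ setF p s, j ≠ b ∧ Dominated (s.y b) (s.y j) := by
        by_contra! hno
        exact hbO ⟨hbF, hno⟩
      obtain ⟨j, hjF, hjb, hdom⟩ := this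
      rw [dominated_iff] at hdom
      obtain ⟨hcA, hcb, hcmax⟩ := hchal j (Or.inl hjF) hjb
      have h1 := hcmax j (Or.inl hjF) hjb
      have h2 := h.smallMHat_lt b c
      exact hopt hbO' hcA hcb (by linarith [h.beta_pos j])
    · exact hsub hbS fun hcA hcb => lt_beta_add_beta_of_xi_neg hb2.2 hcA hcb
  · have hZ1 : Z1 p s < 0 := by
      by_contra! hZ1
      exact hs ⟨hZ1, hZ2⟩
    -- a challenger that is not in `F_t` is confidently dominated, and its dominator
    -- would have been a better challenger
    have hneg : b ∈ setO p s → c ∈ setF p s ∪ setG p s → c ≠ b →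
        smallM (s.y b) (s.y c) < 0 := by
      intro hbO hcA hcb
      by_contra! hle
      by_cases hcF : c ∈ setF p s
      · exact hbO.2 c hcF hcb (dominated_iff.2 hle)
      · obtain ⟨k, hkA, hkc, hk⟩ := exists_of_Z2_nonneg hZ2 hcA fun hcO => hcF hcO.1
        have hkpos := h.beta_pos k
        by_cases hkb : k = b
        · subst hkb
          linarith [smallM_add_smallM_comm (s.y k) (s.y c)]
        · have h1 := (hchal c hcA hcb).2.2 k hkA hkb
          linarith [smallM_triangle (s.y b) (s.y c) (s.y k)]
    obtain hF | hPS := le_or_gt (Z1F p s) (Z1PS p s)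
    · have hb1 := hb.2.1 hZ2 hF
      have hZF : Z1F p s < 0 := by rwa [Z1, min_eq_left hF] at hZ1
      obtain ⟨i, hiO, hi⟩ := exists_of_biInf_lt hZF
      have hbneg : gam p s b < 0 := (hb1.2 i hiO).trans_lt hi
      have hbS : b ∈ S := (hOS b (Or.inl rfl) (Or.inl hb1.1.1)).resolve_left fun hbO =>
        hgam b (Or.inl rfl) hbneg (Or.inl hbO)
      exact hsub hbS fun hcA hcb => by linarith [hneg hb1.1 hcA hcb]
    · have hb1 := hb.2.2 hZ2 hPS
      have hZP : Z1PS p s < 0 := by rwa [Z1, min_eq_right hPS.le] at hZ1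
      obtain ⟨i, hiO, hi⟩ := exists_of_biInf_lt hZP
      obtain ⟨j, ⟨hjO, hjb⟩, hj⟩ := exists_of_biInf_lt (T := setO p s \ {b})
        ((hb1.2 i hiO).trans_lt hi)
      rw [← EReal.coe_zero, EReal.coe_lt_coe_iff, bigMLow, bigM_eq_neg_smallM] at hj
      obtain hbO | hbS := hOS b (Or.inl rfl) (Or.inl hb1.1.1)
      · obtain ⟨hcA, hcb, hcmax⟩ := hchal j (Or.inl hjO.1) hjb
        have h1 := hcmax j (Or.inl hjO.1) hjb
        have h2 := h.smallMHat_lt b c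
        exact hopt hbO hcA hcb (by linarith)
      · exact hsub hbS fun hcA hcb => by linarith [hneg hb1.1 hcA hcb]

end Sampling

/-! ### Concentration of the empirical means -/

section Net

/-- A net of at most `5 ^ d` unit vectors that computes the Euclidean norm up to a factor `2`. -/
lemma exists_half_net (d : ℕ) : ∃ Z : Finset (Vec d), Z.card ≤ 5 ^ d ∧ (∀ z ∈ Z, ‖z‖ = 1) ∧
    ∀ v : Vec d, v ≠ 0 → ∃ z ∈ Z, ‖v‖ ≤ 2 * inner ℝ z v := by
  classical
  let Q : Finset (Vec d) → Prop := fun Z =>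
    (∀ z ∈ Z, ‖z‖ = 1) ∧ ∀ z ∈ Z, ∀ w ∈ Z, z ≠ w → 1 / 2 ≤ ‖z - w‖
  have hcard : ∀ Z, Q Z → Z.card ≤ 5 ^ d := by
    intro Z hZ
    have hinj : Function.Injective fun z : Vec d => (2 : ℝ) • z :=
      smul_right_injective _ two_ne_zero
    have := Besicovitch.card_le_of_separated (Z.image fun z : Vec d => (2 : ℝ) • z) ?_ ?_
    · rwa [Finset.card_image_of_injective _ hinj, finrank_euclideanSpace_fin] at this
    · simp only [Finset.mem_image, forall_exists_index, and_imp, forall_apply_eq_imp_iff₂]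
      intro z hz
      rw [norm_smul, hZ.1 z hz]
      norm_num
    · simp only [Finset.mem_image, forall_exists_index, and_imp, forall_apply_eq_imp_iff₂]
      intro z hz w hw hne
      rw [← smul_sub, norm_smul]
      have := hZ.2 z hz w hw fun e => hne (by rw [e])
      norm_num
      linarith
  -- a separated family of maximal cardinality
  have hbdd : BddAbove {n | ∃ Z, Q Z ∧ Z.card = n} := ⟨5 ^ d, by
    rintro _ ⟨Z, hZ, rfl⟩
    exact hcard Z hZ⟩
  obtain ⟨Z, hZ, hZn⟩ := Nat.sSup_mem (s := {n | ∃ Z, Q Z ∧ Z.card = n})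
    ⟨0, ∅, by simp [Q], rfl⟩ hbdd
  refine ⟨Z, hcard Z hZ, hZ.1, fun v hv => ?_⟩
  have hv0 : 0 < ‖v‖ := norm_pos_iff.2 hv
  set u : Vec d := ‖v‖⁻¹ • v with hu
  have hu1 : ‖u‖ = 1 := by rw [hu, norm_smul, norm_inv, norm_norm, inv_mul_cancel₀ hv0.ne']
  obtain ⟨z, hz, hzu⟩ : ∃ z ∈ Z, ‖z - u‖ ≤ 1 / 2 := by
    by_contra! hfar
    have huZ : u ∉ Z := fun h => by
      have := hfar u h
      norm_num at this
    have hQ : Q (insert u Z) := by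
      refine ⟨fun z hz => ?_, fun z hz w hw hne => ?_⟩
      · obtain rfl | hz := Finset.mem_insert.1 hz
        exacts [hu1, hZ.1 z hz]
      · obtain rfl | hz := Finset.mem_insert.1 hz <;> obtain rfl | hw := Finset.mem_insert.1 hw
        · exact absurd rfl hne
        · rw [norm_sub_rev]
          exact (hfar w hw).le
        · exact (hfar z hz).le
        · exact hZ.2 z hz w hw hne
    have := le_csSup hbdd ⟨_, hQ, rfl⟩
    rw [Finset.card_insert_of_notMem huZ, ← hZn] at this
    omega
  refine ⟨z, hz, ?_⟩
  have h1 := norm_sub_sq_real z u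
  rw [hZ.1 z hz, hu1] at h1
  have h2 : ‖z - u‖ ^ 2 ≤ (1 / 2) ^ 2 := by gcongr
  have h3 : inner ℝ z v = ‖v‖ * inner ℝ z u := by
    rw [hu, inner_smul_right, mul_inv_cancel_left₀ hv0.ne']
  rw [h3]
  nlinarith

end Net

section Tail

variable {K d : ℕ}

instance (ν : Fin K → ProbabilityMeasure (Vec d)) : IsProbabilityMeasure (tableLaw ν) := by
  unfold tableLaw
  infer_instance

lemma tableLaw_sum_ge_le (ν : Fin K → ProbabilityMeasure (Vec d)) (i : Fin K) {φ : Vec d → ℝ}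
    (hφ : Measurable φ) {v : NNReal}
    (hsub : ProbabilityTheory.HasSubgaussianMGF φ v (ν i : Measure (Vec d))) (n : ℕ) {ε : ℝ}
    (hε : 0 ≤ ε) :
    (tableLaw ν).real {x | ε ≤ ∑ r ∈ Finset.range n, φ (x (i, r))}
      ≤ Real.exp (-ε ^ 2 / (2 * n * v)) := by
  have hind : ProbabilityTheory.iIndepFun
      (fun (r : ℕ) (x : Table K d) => φ (x (i, r))) (tableLaw ν) := by
    have h := ProbabilityTheory.iIndepFun_infinitePi
      (P := fun q : Fin K × ℕ => (ν q.1 : Measure (Vec d))) (X := fun _ => φ) (fun _ => hφ)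
    exact h.precomp (g := fun r : ℕ => (i, r)) (Prod.mk_right_injective i)
  refine ProbabilityTheory.HasSubgaussianMGF.measure_sum_range_ge_le_of_iIndepFun hind ?_ hε
  intro r _
  have hmap := measurePreserving_eval_infinitePi
    (fun q : Fin K × ℕ => (ν q.1 : Measure (Vec d))) (i, r)
  refine ProbabilityTheory.HasSubgaussianMGF.of_map (Y := Function.eval (i, r))
    hmap.measurable.aemeasurable ?_
  rw [tableLaw, hmap.map_eq]
  exact hsub

/-- The empirical mean of the first `n` observations of arm `i`. -/
noncomputable def tableMean (n : ℕ) (x : Table K d) (i : Fin K) : Vec d :=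
  (n : ℝ)⁻¹ • ∑ r ∈ Finset.range n, x (i, r)

lemma measurable_tableMean (n : ℕ) (i : Fin K) :
    Measurable fun x : Table K d => tableMean n x i := by
  unfold tableMean
  fun_prop

/-- The empirical mean of the first `n` observations of arm `i` leaves one of the confidence
regions for the thresholds `u` and `w`. -/
def deviation (σ σu u w : ℝ) (n : ℕ) (i : Fin K) (μ : Vec d) : Set (Table K d) :=
  {x | (∃ c, √(2 * σ ^ 2 * u / n) ≤ |tableMean n x i c - μ c|) ∨
    √(2 * σu ^ 2 * w / n) ≤ ‖tableMean n x i - μ‖}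

lemma measurableSet_deviation (σ σu u w : ℝ) (n : ℕ) (i : Fin K) (μ : Vec d) :
    MeasurableSet (deviation σ σu u w n i μ) := by
  have h := measurable_tableMean (d := d) n i
  have heq : deviation σ σu u w n i μ
      = (⋃ c, {x : Table K d | √(2 * σ ^ 2 * u / n) ≤ |tableMean n x i c - μ c|}) ∪
        {x | √(2 * σu ^ 2 * w / n) ≤ ‖tableMean n x i - μ‖} := by
    ext x
    simp [deviation]
  rw [heq]
  refine MeasurableSet.union ?_ ?_
  · refine MeasurableSet.iUnion fun c => measurableSet_le measurable_const ?_
    fun_prop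
  · refine measurableSet_le measurable_const ?_
    fun_prop

/-- The linear functional `φ` of the deviation of the empirical mean is as concentrated as the
mean of `n` independent `s`-subGaussian variables. -/
lemma tableLaw_linear_ge_le (ν : Fin K → ProbabilityMeasure (Vec d)) (i : Fin K)
    (φ : Vec d →L[ℝ] ℝ) (μ : Vec d) {s : ℝ} (hs : 0 < s)
    (hsub : ProbabilityTheory.HasSubgaussianMGF (fun x => φ (x - μ)) (s ^ 2).toNNReal
      (ν i : Measure (Vec d))) {n : ℕ} (hn : 0 < n) {u : ℝ} (hu : 0 ≤ u) :
    (tableLaw ν).real {x | √(2 * s ^ 2 * u / n) ≤ φ (tableMean n x i - μ)} ≤ Real.exp (-u) := by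
  have hn' : (0 : ℝ) < n := by exact_mod_cast hn
  have h := tableLaw_sum_ge_le ν i (φ := fun x => φ (x - μ)) (by fun_prop) hsub n
    (ε := n * √(2 * s ^ 2 * u / n)) (by positivity)
  have hexp : -(n * √(2 * s ^ 2 * u / n)) ^ 2 / (2 * n * ((s ^ 2).toNNReal : ℝ)) = -u := by
    rw [Real.coe_toNNReal _ (by positivity), mul_pow, Real.sq_sqrt (by positivity)]
    field_simp
  rw [hexp] at h
  refine (le_of_eq ?_).trans h
  congr 1
  ext x
  have : ∑ r ∈ Finset.range n, φ (x (i, r) - μ) = n * φ (tableMean n x i - μ) := by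
    simp only [tableMean, map_sub, map_smul, map_sum, Finset.sum_sub_distrib, Finset.sum_const,
      Finset.card_range, nsmul_eq_mul, smul_eq_mul]
    field_simp
  simp only [Set.mem_ofPred_eq, this]
  exact (mul_le_mul_iff_right₀ hn').symm

lemma tableLaw_deviation_le {σ σu : ℝ} (hσ : 0 < σ) (hσu : 0 < σu)
    {ν : Fin K → ProbabilityMeasure (Vec d)} {i : Fin K} (hν : ν i ∈ subGaussianClass d σ σu)
    {n : ℕ} (hn : 0 < n) {u w : ℝ} (hu : 0 ≤ u) (hw : 0 < w) :
    (tableLaw ν).real (deviation σ σu u w n i (mean (ν i)))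
      ≤ d * (2 * Real.exp (-u)) + 5 ^ d * Real.exp (-(w / 4)) := by
  obtain ⟨-, hcoord, hnorm⟩ := hν
  obtain ⟨Z, hZcard, hZ1, hZ⟩ := exists_half_net d
  set μ := mean (ν i) with hμ
  have hn' : (0 : ℝ) < n := by exact_mod_cast hn
  let U : Fin d → Set (Table K d) := fun c =>
    {x | √(2 * σ ^ 2 * u / n) ≤ EuclideanSpace.proj (𝕜 := ℝ) c (tableMean n x i - μ)}
  let U' : Fin d → Set (Table K d) := fun c =>
    {x | √(2 * σ ^ 2 * u / n) ≤ (-EuclideanSpace.proj (𝕜 := ℝ) c) (tableMean n x i - μ)}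
  let W : Vec d → Set (Table K d) := fun z =>
    {x | √(2 * σu ^ 2 * (w / 4) / n) ≤ innerSL ℝ z (tableMean n x i - μ)}
  have hsqrt : √(2 * σu ^ 2 * w / n) = 2 * √(2 * σu ^ 2 * (w / 4) / n) := by
    rw [show 2 * σu ^ 2 * w / n = 2 ^ 2 * (2 * σu ^ 2 * (w / 4) / n) by ring,
      Real.sqrt_mul (by positivity), Real.sqrt_sq (by positivity)]
  have hsub : deviation σ σu u w n i μ
      ⊆ (⋃ c ∈ (Finset.univ : Finset (Fin d)), (U c ∪ U' c)) ∪ ⋃ z ∈ Z, W z := by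
    rintro x (⟨c, hc⟩ | hx)
    · refine Or.inl (Set.mem_iUnion₂.2 ⟨c, Finset.mem_univ c, ?_⟩)
      exact le_abs.1 hc
    · refine Or.inr ?_
      have hpos : 0 < ‖tableMean n x i - μ‖ := lt_of_lt_of_le (by positivity) hx
      obtain ⟨z, hz, hzle⟩ := hZ _ (norm_pos_iff.1 hpos)
      refine Set.mem_iUnion₂.2 ⟨z, hz, ?_⟩
      have := hsqrt ▸ hx
      simp only [W, Set.mem_ofPred_eq, innerSL_apply_apply]
      linarith
  have hU : ∀ c, (tableLaw ν).real (U c ∪ U' c) ≤ 2 * Real.exp (-u) := by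
    intro c
    refine (measureReal_union_le _ _).trans ?_
    have h1 := tableLaw_linear_ge_le ν i (EuclideanSpace.proj (𝕜 := ℝ) c) μ hσ
      (hcoord c) hn hu
    have h2 := tableLaw_linear_ge_le ν i (-EuclideanSpace.proj (𝕜 := ℝ) c) μ hσ
      (hcoord c).neg hn hu
    linarith
  have hW : ∀ z ∈ Z, (tableLaw ν).real (W z) ≤ Real.exp (-(w / 4)) := fun z hz =>
    tableLaw_linear_ge_le ν i (innerSL ℝ z) μ hσu (hnorm z (hZ1 z hz)) hn (by positivity)
  calc (tableLaw ν).real (deviation σ σu u w n i μ)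
      ≤ _ := measureReal_mono hsub
    _ ≤ _ := measureReal_union_le _ _
    _ ≤ ∑ c : Fin d, 2 * Real.exp (-u) + ∑ z ∈ Z, Real.exp (-(w / 4)) := by
        gcongr ?_ + ?_
        · exact (measureReal_biUnion_finset_le _ _).trans (Finset.sum_le_sum fun c _ => hU c)
        · exact (measureReal_biUnion_finset_le _ _).trans (Finset.sum_le_sum hW)
    _ ≤ _ := by
        simp only [Finset.sum_const, Finset.card_univ, Fintype.card_fin, nsmul_eq_mul]
        gcongr
        exact_mod_cast hZcard

/-- The deviation at the thresholds of round `t`. -/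
def roundDeviation (σ σu α k₁ δ : ℝ) (t n : ℕ) (i : Fin K) (μ : Vec d) : Set (Table K d) :=
  deviation σ σu (fThr K d α k₁ t δ) (gThr K d α k₁ t δ) n i μ

lemma tableLaw_roundDeviation_le (hd : 1 ≤ d) {σ σu α k₁ δ : ℝ} (hσ : 0 < σ)
    (hσu : 0 < σu) (hα : 0 ≤ α) (hk₁ : 1 ≤ k₁) (hδ0 : 0 < δ) (hδ1 : δ ≤ 1)
    {ν : Fin K → ProbabilityMeasure (Vec d)} {i : Fin K} (hν : ν i ∈ subGaussianClass d σ σu)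
    {n t : ℕ} (hn : 0 < n) (ht : 0 < t) :
    (tableLaw ν).real (roundDeviation σ σu α k₁ δ t n i (mean (ν i)))
      ≤ 3 * δ / (4 * k₁ * K) * (t : ℝ) ^ (-α) := by
  have hK : (1 : ℝ) ≤ K := by exact_mod_cast (Fin.pos i)
  have hd' : (1 : ℝ) ≤ d := by exact_mod_cast hd
  have ht' : (1 : ℝ) ≤ (t : ℝ) ^ α := Real.one_le_rpow (by exact_mod_cast ht) hα
  have hpow : (1 : ℝ) ≤ 5 ^ d := one_le_pow₀ (by norm_num)
  have h4 : 4 ≤ 4 * k₁ * K := by nlinarith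
  have hA : 1 < 4 * k₁ * K * d * (t : ℝ) ^ α / δ := by
    rw [lt_div_iff₀ hδ0]
    have : 4 ≤ 4 * k₁ * K * d := by nlinarith
    nlinarith
  have hB : 1 < 4 * k₁ * K * 5 ^ d * (t : ℝ) ^ α / δ := by
    rw [lt_div_iff₀ hδ0]
    have : 4 ≤ 4 * k₁ * K * 5 ^ d := by nlinarith
    nlinarith
  refine (tableLaw_deviation_le hσ hσu hν hn (Real.log_nonneg hA.le)
    (mul_pos four_pos (Real.log_pos hB))).trans (le_of_eq ?_)
  rw [mul_div_cancel_left₀ _ four_ne_zero, Real.exp_neg, Real.exp_neg,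
    Real.exp_log (by positivity), Real.exp_log (by positivity), Real.rpow_neg (by positivity)]
  field_simp
  norm_num

end Tail

/-! ### The thresholds -/

section Thresholds

variable {K d : ℕ} {α k₁ : ℝ}

lemma fThr_mono (hK : 1 ≤ K) (hd : 1 ≤ d) (hα : 0 ≤ α) (hk₁ : 0 < k₁) {t t' : ℕ} {δ δ' : ℝ}
    (ht : 0 < t') (htt : t' ≤ t) (hδ : 0 < δ) (hδδ : δ ≤ δ') :
    fThr K d α k₁ t' δ' ≤ fThr K d α k₁ t δ := by
  have hK' : (0 : ℝ) < K := by exact_mod_cast hK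
  have hd' : (0 : ℝ) < d := by exact_mod_cast hd
  have ht' : (0 : ℝ) < t' := by exact_mod_cast ht
  have hδ' := hδ.trans_le hδδ
  unfold fThr
  gcongr

lemma gThr_eq (hK : 1 ≤ K) (hd : 1 ≤ d) (hk₁ : 0 < k₁) {t : ℕ} (ht : 0 < t) {δ : ℝ}
    (hδ : 0 < δ) :
    gThr K d α k₁ t δ = 4 * (fThr K d α k₁ t δ + Real.log (5 ^ d / d)) := by
  have hK' : (0 : ℝ) < K := by exact_mod_cast hK
  have hd' : (0 : ℝ) < d := by exact_mod_cast hd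
  have ht' : (0 : ℝ) < t := by exact_mod_cast ht
  rw [gThr, fThr, ← Real.log_mul (by positivity) (by positivity)]
  congr 2
  field_simp

lemma five_le_five_pow_div (hd : 1 ≤ d) : (5 : ℝ) ≤ 5 ^ d / d := by
  have hd' : (0 : ℝ) < d := by exact_mod_cast hd
  have h : ∀ n : ℕ, (5 : ℝ) * (n + 1 : ℕ) ≤ 5 ^ (n + 1) := by
    intro n
    induction n with
    | zero => norm_num
    | succ n ih =>
      rw [pow_succ]
      push_cast at ih ⊢
      nlinarith
  rw [le_div_iff₀ hd']
  obtain ⟨n, rfl⟩ := Nat.exists_eq_add_of_le' hd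
  exact h n

lemma gThr_mono (hK : 1 ≤ K) (hd : 1 ≤ d) (hα : 0 ≤ α) (hk₁ : 0 < k₁) {t t' : ℕ} {δ δ' : ℝ}
    (ht : 0 < t') (htt : t' ≤ t) (hδ : 0 < δ) (hδδ : δ ≤ δ') :
    gThr K d α k₁ t' δ' ≤ gThr K d α k₁ t δ := by
  rw [gThr_eq hK hd hk₁ ht (hδ.trans_le hδδ), gThr_eq hK hd hk₁ (ht.trans_le htt) hδ]
  linarith [fThr_mono hK hd hα hk₁ ht htt hδ hδδ]

lemma fThr_eq_log_add (hK : 1 ≤ K) (hd : 1 ≤ d) (hk₁ : 0 < k₁) {t : ℕ} (ht : 0 < t) {δ : ℝ}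
    (hδ : 0 < δ) :
    fThr K d α k₁ t δ = Real.log (4 * k₁ * K * d / δ) + α * Real.log t := by
  have hK' : (0 : ℝ) < K := by exact_mod_cast hK
  have hd' : (0 : ℝ) < d := by exact_mod_cast hd
  have ht' : (0 : ℝ) < t := by exact_mod_cast ht
  rw [fThr, ← Real.log_rpow ht', ← Real.log_mul (by positivity) (by positivity)]
  congr 1
  ring

lemma fThr_nonneg (hK : 1 ≤ K) (hd : 1 ≤ d) (hα : 0 ≤ α) (hk₁ : 1 ≤ k₁) {t : ℕ} (ht : 0 < t)
    {δ : ℝ} (hδ : 0 < δ) (hδd : δ ≤ d) : 0 ≤ fThr K d α k₁ t δ := by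
  have hK' : (1 : ℝ) ≤ K := by exact_mod_cast hK
  have ht' : (1 : ℝ) ≤ t := by exact_mod_cast ht
  rw [fThr_eq_log_add hK hd (by linarith) ht hδ]
  have : 1 ≤ 4 * k₁ * K * d / δ := by
    rw [le_div_iff₀ hδ]
    have : 1 ≤ 4 * k₁ * K := by nlinarith
    nlinarith
  have h1 := Real.log_nonneg this
  have h2 := mul_nonneg hα (Real.log_nonneg ht')
  linarith

lemma div_five_pow_pos (hd : 1 ≤ d) : (0 : ℝ) < d / 5 ^ d := by
  have hd' : (0 : ℝ) < d := by exact_mod_cast hd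
  positivity

lemma div_five_pow_le : (d : ℝ) / 5 ^ d ≤ d :=
  div_le_self (Nat.cast_nonneg d) (one_le_pow₀ (by norm_num))

lemma lambdaTerm_nonneg (hK : 1 ≤ K) (hd : 1 ≤ d) (hα : 0 ≤ α) (hk₁ : 1 ≤ k₁) {T : ℕ}
    (hT : 0 < T) : 0 ≤ lambdaTerm K d α k₁ T := by
  have h1 := fThr_nonneg hK hd hα hk₁ hT (div_five_pow_pos hd) div_five_pow_le
  have h2 := fThr_nonneg hK hd hα hk₁ hT one_pos (by exact_mod_cast hd)
  have h3 : 0 ≤ Real.log T := Real.log_natCast_nonneg T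
  unfold lambdaTerm
  positivity

lemma summable_lambdaTerm (hK : 1 ≤ K) (hd : 1 ≤ d) (hα : 2 < α) (hk₁ : 1 ≤ k₁) :
    Summable fun T : ℕ => lambdaTerm K d α k₁ (T + 1) := by
  have hd5 := div_five_pow_pos hd
  set B : ℝ := Real.log (4 * k₁ * K * d / (d / 5 ^ d)) + Real.log (4 * k₁ * K * d / 1)
    + 2 / Real.exp 1 with hB
  -- each logarithm is at most a multiple of `T ^ ε`, and `2 * ε - (α - 1) = -(α / 2) < -1`
  set ε : ℝ := (α - 2) / 4 with hε
  have hε0 : 0 < ε := by rw [hε]; linarith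
  have hsum : Summable fun T : ℕ =>
      (1 / ε + 1) * (|B| + 2 * α / ε) * ((T + 1 : ℕ) : ℝ) ^ (-(α / 2)) :=
    ((summable_nat_add_iff 1).2 (Real.summable_nat_rpow.2 (by linarith))).mul_left _
  refine hsum.of_nonneg_of_le
    (fun T => lambdaTerm_nonneg hK hd (by linarith) hk₁ T.succ_pos) fun T => ?_
  set t : ℕ := T + 1 with ht
  have ht0 : 0 < t := T.succ_pos
  have ht1 : (1 : ℝ) ≤ t := by exact_mod_cast ht0
  have htpos : (0 : ℝ) < t := by linarith
  have hp1 : 1 ≤ (t : ℝ) ^ ε := Real.one_le_rpow ht1 hε0.le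
  have hlog : Real.log t ≤ 1 / ε * (t : ℝ) ^ ε := by
    have := Real.log_le_rpow_div htpos.le hε0
    rwa [one_div_mul_eq_div]
  have hlog0 : 0 ≤ Real.log t := Real.log_nonneg ht1
  have hfac : fThr K d α k₁ t (d / 5 ^ d) + fThr K d α k₁ t 1 + 2 / Real.exp 1
      = B + 2 * α * Real.log t := by
    rw [fThr_eq_log_add hK hd (by linarith) ht0 hd5,
      fThr_eq_log_add hK hd (by linarith) ht0 one_pos, hB]
    ring
  have h1 : Real.log t + 1 ≤ (1 / ε + 1) * (t : ℝ) ^ ε := by linarith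
  have h2 : B + 2 * α * Real.log t ≤ (|B| + 2 * α / ε) * (t : ℝ) ^ ε := by
    have ha : B ≤ |B| * (t : ℝ) ^ ε :=
      (le_abs_self B).trans (le_mul_of_one_le_right (abs_nonneg B) hp1)
    have hb : 2 * α * Real.log t ≤ 2 * α * (1 / ε * (t : ℝ) ^ ε) := by gcongr
    calc _ ≤ |B| * (t : ℝ) ^ ε + 2 * α * (1 / ε * (t : ℝ) ^ ε) := add_le_add ha hb
      _ = _ := by ring
  have hpow : (t : ℝ) ^ ε * (t : ℝ) ^ ε / (t : ℝ) ^ (α - 1) = (t : ℝ) ^ (-(α / 2)) := by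
    rw [← Real.rpow_add htpos, ← Real.rpow_sub htpos, hε]
    congr 1
    ring
  rw [lambdaTerm, hfac, ← hpow, mul_div_assoc', mul_div_assoc']
  refine div_le_div_of_nonneg_right ?_ (by positivity)
  calc (Real.log t + 1) * (B + 2 * α * Real.log t)
      ≤ (Real.log t + 1) * ((|B| + 2 * α / ε) * (t : ℝ) ^ ε) := by gcongr
    _ ≤ (1 / ε + 1) * (t : ℝ) ^ ε * ((|B| + 2 * α / ε) * (t : ℝ) ^ ε) := by gcongr
    _ = _ := by ring

lemma tsum_succ_rpow_le (hα : 1 < α) :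
    Summable (fun n : ℕ => ((n + 1 : ℕ) : ℝ) ^ (-α)) ∧
      ∑' n : ℕ, ((n + 1 : ℕ) : ℝ) ^ (-α) ≤ 1 + 1 / (α - 1) := by
  have hs : Summable (fun n : ℕ => ((n + 1 : ℕ) : ℝ) ^ (-α)) :=
    (summable_nat_add_iff 1).2 (Real.summable_nat_rpow.2 (by linarith))
  refine ⟨hs, ?_⟩
  rw [hs.tsum_eq_zero_add]
  have h1 : (((0 : ℕ) + 1 : ℕ) : ℝ) ^ (-α) = 1 := by simp
  rw [h1]
  gcongr
  refine Real.tsum_le_of_sum_range_le (fun n => by positivity) fun N => ?_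
  have hanti : AntitoneOn (fun x : ℝ => x ^ (-α)) (Set.Icc 1 (1 + (N : ℝ))) := by
    intro x hx z _ hxz
    exact Real.rpow_le_rpow_of_nonpos (by linarith [hx.1]) hxz (by linarith)
  have hint := hanti.sum_le_integral
  rw [integral_rpow (Or.inr ⟨by linarith, by
    rw [Set.uIcc_of_le (by linarith [(Nat.cast_nonneg N : (0 : ℝ) ≤ N)])]
    intro h
    linarith [h.1]⟩)] at hint
  calc ∑ n ∈ Finset.range N, ((n + 1 + 1 : ℕ) : ℝ) ^ (-α)
      = ∑ n ∈ Finset.range N, (1 + ((n + 1 : ℕ) : ℝ)) ^ (-α) := by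
        refine Finset.sum_congr rfl fun n _ => ?_
        push_cast
        ring_nf
    _ ≤ _ := hint
    _ ≤ 1 / (α - 1) := by
        rw [Real.one_rpow, ← neg_div_neg_eq]
        have h : 0 ≤ (1 + (N : ℝ)) ^ (-α + 1) := by positivity
        have : -(-α + 1) = α - 1 := by ring
        rw [this]
        have : 0 < α - 1 := by linarith
        gcongr
        linarith

lemma lt_two_mul_log_of_lt_mul_log {a q x : ℝ} (ha : 0 ≤ a) (hq : 0 < q) (hx : 0 < x)
    (h : x < a * Real.log (q * x)) : x < 2 * a * Real.log (a * q) := by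
  obtain rfl | ha := ha.eq_or_lt
  · linarith
  have h1 : Real.log (q * x) = Real.log (a * q) + Real.log (x / a) := by
    rw [← Real.log_mul (by positivity) (by positivity)]
    congr 1
    field_simp
  have h2 : Real.log (x / a) ≤ x / a / 2 := by
    have h3 : Real.log (x / a) = Real.log (x / a / 2) + Real.log 2 := by
      rw [← Real.log_mul (by positivity) (by positivity)]
      congr 1
      ring
    have h4 := Real.log_le_sub_one_of_pos (x := x / a / 2) (by positivity)
    have h5 := Real.log_two_lt_d9
    linarith
  have h6 : a * (x / a / 2) = x / 2 := by field_simp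
  rw [h1, mul_add] at h
  nlinarith [mul_le_mul_of_nonneg_left h2 ha.le]

end Thresholds

/-! ### Accuracy along a run and `δ`-correctness -/

section Run

variable {K d : ℕ} {b c : ℕ → Table K d → Fin K}

lemma pulls_pos (t : ℕ) (x : Table K d) (i : Fin K) : 0 < pulls b c t x i := by
  unfold pulls
  omega

lemma pulls_le {t : ℕ} (ht : K + 1 ≤ t) (x : Table K d) (i : Fin K) : pulls b c t x i ≤ t := by
  classical
  have h := Finset.card_filter_le (Finset.Ico (K + 1) t) (fun r => b r x = i ∨ c r x = i)
  rw [Nat.card_Ico] at h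
  unfold pulls
  convert (show 1 + (t - (K + 1)) ≤ t by omega).trans' (Nat.add_le_add_left h 1)

/-- The snapshot of round `t` is accurate if, for every arm, the empirical mean stays within the
regions of some earlier round `l n` and of some larger level `δ'`, where `n` is its number of
pulls. -/
lemma accurate_snapshot (hK : 1 ≤ K) (hd : 1 ≤ d) {P : Set (Vec d)} {σ σu α k₁ δ δ' : ℝ}
    (hα : 0 ≤ α) (hk₁ : 0 < k₁) (hδ : 0 < δ) (hδδ : δ ≤ δ') {μ : Fin K → Vec d} {t : ℕ}
    {x : Table K d} (l : ℕ → ℕ)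
    (hx : ∀ i, 0 < l (pulls b c t x i) ∧ l (pulls b c t x i) ≤ t ∧
      x ∉ roundDeviation σ σu α k₁ δ' (l (pulls b c t x i)) (pulls b c t x i) i (μ i)) :
    Accurate (input K P σ σu α k₁ δ) (snapshot b c t x) μ := by
  intro i
  obtain ⟨hl0, hlt, hxi⟩ := hx i
  simp only [roundDeviation, deviation, Set.mem_ofPred_eq, not_or, not_exists, not_le] at hxi
  refine ⟨pulls_pos t x i, fun c' => (hxi.1 c').trans_le ?_, hxi.2.trans_le ?_⟩
  · refine Real.sqrt_le_sqrt ?_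
    simp only [snapshot, input]
    gcongr
    exact fThr_mono hK hd hα hk₁ hl0 hlt hδ hδδ
  · refine Real.sqrt_le_sqrt ?_
    simp only [snapshot, input]
    gcongr
    exact gThr_mono hK hd hα hk₁ hl0 hlt hδ hδδ

lemma stops_of_stopTime_eq {p : Input d} {x : Table K d} {t : ℕ} (h : stopTime p b c x = t) :
    K + 1 ≤ t ∧ Stops p (snapshot b c t x) := by
  have hne : {t : ℕ | K + 1 ≤ t ∧ Stops p (snapshot b c t x)}.Nonempty := by
    by_contra hem
    rw [Set.not_nonempty_iff_eq_empty] at hem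
    have : stopTime p b c x = ⊤ := by
      unfold stopTime
      refine iInf₂_eq_top.2 fun r hr => ?_
      have : r ∈ ({t : ℕ | K + 1 ≤ t ∧ Stops p (snapshot b c t x)} : Set ℕ) := hr
      rw [hem] at this
      exact this.elim
    rw [this] at h
    exact ENat.top_ne_natCast t h
  have hmem := Nat.sInf_mem hne
  have heq : stopTime p b c x = (sInf {t : ℕ | K + 1 ≤ t ∧ Stops p (snapshot b c t x)} : ℕ) := by
    refine le_antisymm (iInf₂_le _ hmem) (le_iInf₂ fun r hr => ?_)
    exact_mod_cast Nat.sInf_le hr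
  rw [heq] at h
  have h' : sInf {t : ℕ | K + 1 ≤ t ∧ Stops p (snapshot b c t x)} = t := by exact_mod_cast h
  rw [h'] at hmem
  exact hmem

lemma not_stops_of_lt_stopTime {p : Input d} {x : Table K d} {t : ℕ} (ht : K + 1 ≤ t)
    (h : (t : ℕ∞) < stopTime p b c x) : ¬ Stops p (snapshot b c t x) := fun hs =>
  h.not_ge (iInf₂_le t ⟨ht, hs⟩)

theorem deltaCorrect (hK : 1 ≤ K) (hd : 1 ≤ d) (P : Set (Vec d)) {σ σu α k₁ δ : ℝ}
    (hσ : 0 < σ) (hσu : 0 < σu) (hα : 1 < α) (hk₁ : 1 + 1 / (α - 1) < k₁) (hδ0 : 0 < δ)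
    (hδ1 : δ ≤ 1) :
    DeltaCorrect δ P (subGaussianClass d σ σu) (stopTime (input K P σ σu α k₁ δ) b c)
      (recommendation (input K P σ σu α k₁ δ) b c) := by
  have : NeZero d := ⟨by omega⟩
  refine ⟨fun x t _ => isPartition_recommend _ _, fun ν hν => ?_⟩
  have hα1 : 0 < 1 / (α - 1) := by
    have : 0 < α - 1 := by linarith
    positivity
  have hk : 1 ≤ k₁ := by linarith
  have hK' : (0 : ℝ) < K := by exact_mod_cast hK
  obtain ⟨hsum, hle⟩ := tsum_succ_rpow_le hα
  -- the confidence regions with the threshold of round `n` after `n` pulls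
  have hsub : {x | ∃ t : ℕ, stopTime (input K P σ σu α k₁ δ) b c x = t ∧
      ¬ IsCorrect P (fun i => mean (ν i)) (recommendation (input K P σ σu α k₁ δ) b c t x)}
      ⊆ ⋃ n : ℕ, ⋃ i : Fin K, roundDeviation σ σu α k₁ δ (n + 1) (n + 1) i (mean (ν i)) := by
    rintro x ⟨t, hτ, hcor⟩
    obtain ⟨ht, hs⟩ := stops_of_stopTime_eq hτ
    by_contra hx
    simp only [Set.mem_iUnion, not_exists] at hx
    refine hcor ((accurate_snapshot hK hd (by linarith) (by linarith) hδ0 le_rfl id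
      fun i => ⟨pulls_pos t x i, pulls_le ht x i, ?_⟩).isCorrect_of_stops hσu hs)
    obtain ⟨n, hn⟩ := Nat.exists_eq_add_of_le' (pulls_pos (b := b) (c := c) t x i)
    rw [hn]
    exact hx n i
  calc _ ≤ _ := measure_mono hsub
    _ ≤ ∑' n : ℕ, ∑ i : Fin K,
        tableLaw ν (roundDeviation σ σu α k₁ δ (n + 1) (n + 1) i (mean (ν i))) :=
      (measure_iUnion_le _).trans
        (ENNReal.tsum_le_tsum fun n => measure_iUnion_fintype_le _ _)
    _ ≤ ∑' n : ℕ, ENNReal.ofReal (3 * δ / (4 * k₁) * ((n + 1 : ℕ) : ℝ) ^ (-α)) := by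
        refine ENNReal.tsum_le_tsum fun n => ?_
        have hone : ∀ i : Fin K,
            tableLaw ν (roundDeviation σ σu α k₁ δ (n + 1) (n + 1) i (mean (ν i)))
              ≤ ENNReal.ofReal (3 * δ / (4 * k₁ * K) * ((n + 1 : ℕ) : ℝ) ^ (-α)) := fun i => by
          rw [← ofReal_measureReal]
          exact ENNReal.ofReal_le_ofReal (tableLaw_roundDeviation_le hd hσ hσu (by linarith) hk
            hδ0 hδ1 (hν i) n.succ_pos n.succ_pos)
        refine (Finset.sum_le_sum fun i _ => hone i).trans (le_of_eq ?_)
        rw [Finset.sum_const, Finset.card_univ, Fintype.card_fin, nsmul_eq_mul,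
          ← ENNReal.ofReal_natCast, ← ENNReal.ofReal_mul (by positivity)]
        congr 1
        field_simp
    _ = ENNReal.ofReal (3 * δ / (4 * k₁) * ∑' n : ℕ, ((n + 1 : ℕ) : ℝ) ^ (-α)) := by
        rw [← tsum_mul_left, ENNReal.ofReal_tsum_of_nonneg (fun n => by positivity)
          (hsum.mul_left _)]
    _ ≤ ENNReal.ofReal δ := by
        refine ENNReal.ofReal_le_ofReal ?_
        rw [div_mul_eq_mul_div, div_le_iff₀ (by positivity)]
        nlinarith

end Run

/-! ### Counting the rounds before stopping -/

section Counting

variable {K d : ℕ} {b c : ℕ → Table K d → Fin K}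

/-- At the last round of `Q`, the arm `a` has already been pulled in all the other ones and in the
initialization. -/
lemma card_le_of_pulls_le {x : Table K d} {a : Fin K} {B : ℝ≥0∞} {Q : Finset ℕ}
    (hQ : ∀ t ∈ Q, K + 1 ≤ t ∧ (b t x = a ∨ c t x = a) ∧ (pulls b c t x a : ℝ≥0∞) ≤ B) :
    (Q.card : ℝ≥0∞) ≤ B := by
  classical
  obtain rfl | hne := Q.eq_empty_or_nonempty
  · simp
  have hT := Q.max'_mem hne
  refine le_trans ?_ (hQ _ hT).2.2
  have hsub : Q.erase (Q.max' hne) ⊆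
      (Finset.Ico (K + 1) (Q.max' hne)).filter (fun r => b r x = a ∨ c r x = a) := by
    intro r hr
    have hrQ := Finset.mem_of_mem_erase hr
    refine Finset.mem_filter.2 ⟨Finset.mem_Ico.2 ⟨(hQ r hrQ).1, ?_⟩, (hQ r hrQ).2.1⟩
    exact lt_of_le_of_ne (Q.le_max' r hrQ) (Finset.ne_of_mem_erase hr)
  have hcard := Finset.card_le_card hsub
  rw [Finset.card_erase_of_mem hT] at hcard
  have h1 : Q.card ≤
      1 + ((Finset.Ico (K + 1) (Q.max' hne)).filter (fun r => b r x = a ∨ c r x = a)).card := by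
    omega
  have : Q.card ≤ pulls b c (Q.max' hne) x a := by
    unfold pulls
    convert h1
  exact_mod_cast this

lemma card_Icc_le_sum_of_pulls_le {x : Table K d} {t₀ T : ℕ} (ht₀ : K + 1 ≤ t₀) (B : Fin K → ℝ≥0∞)
    (h : ∀ t ∈ Finset.Icc t₀ T, ∃ a, (b t x = a ∨ c t x = a) ∧ (pulls b c t x a : ℝ≥0∞) ≤ B a) :
    ((Finset.Icc t₀ T).card : ℝ≥0∞) ≤ ∑ a, B a := by
  classical
  let Q : Fin K → Finset ℕ := fun a => (Finset.Icc t₀ T).filter fun t =>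
    (b t x = a ∨ c t x = a) ∧ (pulls b c t x a : ℝ≥0∞) ≤ B a
  have hsub : Finset.Icc t₀ T ⊆ Finset.univ.biUnion Q := by
    intro t ht
    obtain ⟨a, ha⟩ := h t ht
    exact Finset.mem_biUnion.2 ⟨a, Finset.mem_univ a, Finset.mem_filter.2 ⟨ht, ha⟩⟩
  calc ((Finset.Icc t₀ T).card : ℝ≥0∞) ≤ ((∑ a, (Q a).card : ℕ) : ℝ≥0∞) := by
        exact_mod_cast (Finset.card_le_card hsub).trans Finset.card_biUnion_le
    _ = ∑ a, ((Q a).card : ℝ≥0∞) := by push_cast; rfl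
    _ ≤ ∑ a, B a := by
        refine Finset.sum_le_sum fun a _ => card_le_of_pulls_le (b := b) (c := c) (x := x)
          (a := a) fun t ht => ?_
        obtain ⟨ht1, ht2⟩ := Finset.mem_filter.1 ht
        exact ⟨ht₀.trans (Finset.mem_Icc.1 ht1).1, ht2⟩

open Classical in
/-- The bounds on the numbers of pulls of the under-explored arms add up to the complexity and to
the additional cost of feasibility. -/
lemma sum_pull_bounds_le {P : Set (Vec d)} {y : Fin K → Vec d} {S I : Set (Fin K)}
    (hv : (S, I) ∈ validAnswers P y) (σ σu : ℝ) {u L : ℝ} (hu : 0 ≤ u) (hL : 0 ≤ L)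
    (hLd : L = Real.log (5 ^ d / d)) :
    ∑ a, ((if a ∈ optSet P y then
          max (ENNReal.ofReal (16 * u) * gapCost σ (optSet P y ∪ S) y a)
            (ENNReal.ofReal (4 * (4 * (u + L))) * feasCost σu P (y a)) else 0)
        + (if a ∈ S then ENNReal.ofReal (16 * u) * gapCost σ (optSet P y ∪ S) y a else 0)
        + (if a ∈ I then ENNReal.ofReal (4 * (4 * (u + L))) * feasCost σu P (y a) else 0))
      ≤ ENNReal.ofReal (16 * u) * complexity σ σu P y S I + feasSum σu P y := by
  have hX : ENNReal.ofReal (4 * (4 * (u + L)))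
      = ENNReal.ofReal (16 * u) + ENNReal.ofReal (16 * L) := by
    rw [← ENNReal.ofReal_add (by positivity) (by positivity)]
    congr 1
    ring
  have hH : ∀ a, ENNReal.ofReal (32 * σu ^ 2 * Real.log (5 ^ d / d)) / eta P (y a) ^ 2
      = ENNReal.ofReal (16 * L) * feasCost σu P (y a) := by
    intro a
    rw [feasCost, ← mul_div_assoc, ← ENNReal.ofReal_mul (by positivity), ← hLd]
    congr 2
    ring
  have hfeas : ∑ a, ((if a ∈ optSet P y then ENNReal.ofReal (16 * L) * feasCost σu P (y a) else 0)
      + (if a ∈ I then ENNReal.ofReal (16 * L) * feasCost σu P (y a) else 0))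
      ≤ feasSum σu P y := by
    unfold feasSum
    rw [Finset.sum_filter]
    refine Finset.sum_le_sum fun a _ => ?_
    rw [hH]
    by_cases haO : a ∈ optSet P y
    · have haI : a ∉ I := fun h => hv.2.1 h haO.1
      simp [haO, haI]
    · by_cases haI : a ∈ I
      · have : a ∉ feasible P y := hv.2.1 haI
        simp [haO, haI, this]
      · simp [haO, haI]
  refine le_trans ?_ (add_le_add_right hfeas _)
  unfold complexity
  rw [Finset.sum_filter, Finset.sum_filter, Finset.sum_filter, ← Finset.sum_add_distrib,
    ← Finset.sum_add_distrib, Finset.mul_sum, ← Finset.sum_add_distrib]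
  refine Finset.sum_le_sum fun a _ => ?_
  rw [hX, add_mul]
  set X := ENNReal.ofReal (16 * u)
  set Y := ENNReal.ofReal (16 * L)
  set g := gapCost σ (optSet P y ∪ S) y a
  set e := feasCost σu P (y a)
  have h1 : (if a ∈ optSet P y then max (X * g) (X * e + Y * e) else 0)
      ≤ X * (if a ∈ optSet P y then max g e else 0)
        + (if a ∈ optSet P y then Y * e else 0) := by
    split_ifs
    · refine max_le ?_ ?_
      · exact (mul_le_mul_right (le_max_left _ _) _).trans le_self_add
      · gcongr
        exact le_max_right _ _
    · simp
  have h2 : (if a ∈ S then X * g else 0) = X * (if a ∈ S then g else 0) := by split_ifs <;> simp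
  have h3 : (if a ∈ I then X * e + Y * e else 0)
      = X * (if a ∈ I then e else 0) + (if a ∈ I then Y * e else 0) := by split_ifs <;> simp
  rw [h2, h3, mul_add, mul_add]
  refine (add_le_add_left (add_le_add_left h1 _) _).trans (le_of_eq ?_)
  abel

lemma gap_pos_of_complexity_ne_top {P : Set (Vec d)} {y : Fin K → Vec d} {S I : Set (Fin K)}
    {σ σu : ℝ} (hσ : 0 < σ) (h : complexity σ σu P y S I ≠ ⊤) {i : Fin K} (hi : i ∈ S) :
    0 < gap (optSet P y ∪ S) y i := by
  classical
  by_contra! hle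
  refine h ?_
  have htop : gapCost σ (optSet P y ∪ S) y i = ⊤ := by
    rw [gapCost, EReal.toENNReal_of_nonpos hle, zero_pow two_ne_zero, ENNReal.div_zero]
    simp [hσ.ne']
  refine top_unique ?_
  calc ⊤ = gapCost σ (optSet P y ∪ S) y i := htop.symm
    _ ≤ ∑ i with i ∈ S, gapCost σ (optSet P y ∪ S) y i :=
        Finset.single_le_sum (f := fun i => gapCost σ (optSet P y ∪ S) y i)
          (fun _ _ => zero_le) (Finset.mem_filter.2 ⟨Finset.mem_univ i, hi⟩)
    _ ≤ complexity σ σu P y S I := by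
        unfold complexity
        refine le_trans ?_ le_self_add
        exact le_add_self

end Counting

/-! ### Failure probabilities in the later half of the first `T` rounds -/

section Failure

variable {K d : ℕ}

/-- After some number `n ≤ T` of pulls, the empirical mean of some arm leaves the confidence regions
given by the thresholds of round `⌈T / 2⌉` at level `δ = 1`, which no threshold in use between
the rounds `T / 2` and `T` falls below. The event is empty for `T < 2`, where it is not needed: the
bound on the expected stopping time exceeds `2`. -/
def badEvent (σ σu α k₁ : ℝ) (μ : Fin K → Vec d) (T : ℕ) : Set (Table K d) :=
  {x | 2 ≤ T ∧ ∃ i, ∃ n ∈ Finset.Icc 1 T,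
    x ∈ roundDeviation σ σu α k₁ 1 ((T + 1) / 2) n i (μ i)}

lemma badEvent_eq (σ σu α k₁ : ℝ) (μ : Fin K → Vec d) {T : ℕ} (hT : 2 ≤ T) :
    badEvent σ σu α k₁ μ T
      = ⋃ i, ⋃ n ∈ Finset.Icc 1 T, roundDeviation σ σu α k₁ 1 ((T + 1) / 2) n i (μ i) := by
  ext x
  simp only [badEvent, hT, true_and, Set.mem_iUnion, exists_prop, Set.mem_ofPred_eq]

lemma badEvent_eq_empty (σ σu α k₁ : ℝ) (μ : Fin K → Vec d) {T : ℕ} (hT : T < 2) :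
    badEvent σ σu α k₁ μ T = ∅ := by
  ext x
  simp [badEvent, hT]

lemma measurableSet_badEvent (σ σu α k₁ : ℝ) (μ : Fin K → Vec d) (T : ℕ) :
    MeasurableSet (badEvent σ σu α k₁ μ T) := by
  obtain hT | hT := lt_or_ge T 2
  · rw [badEvent_eq_empty _ _ _ _ _ hT]
    exact MeasurableSet.empty
  · rw [badEvent_eq _ _ _ _ _ hT]
    exact MeasurableSet.iUnion fun i => Finset.measurableSet_biUnion _ fun n _ =>
      measurableSet_deviation _ _ _ _ _ _ _

lemma six_le_fThr_add_fThr (hK : 1 ≤ K) (hd : 1 ≤ d) {α k₁ : ℝ} (hα : 2 ≤ α) (hk₁ : 1 ≤ k₁)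
    {T : ℕ} (hT : 2 ≤ T) : 6 ≤ fThr K d α k₁ T (d / 5 ^ d) + fThr K d α k₁ T 1 := by
  have hK' : (1 : ℝ) ≤ K := by exact_mod_cast hK
  have hd' : (1 : ℝ) ≤ d := by exact_mod_cast hd
  have hpow : (5 : ℝ) ≤ 5 ^ d := by
    calc (5 : ℝ) = 5 ^ 1 := by norm_num
      _ ≤ 5 ^ d := pow_le_pow_right₀ (by norm_num) hd
  have hT' : (2 : ℝ) ≤ T := by exact_mod_cast hT
  have hlogT : Real.log 2 ≤ Real.log T := Real.log_le_log two_pos hT'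
  have h2 := Real.log_two_gt_d9
  have h4 : Real.log 4 = 2 * Real.log 2 := by
    rw [show (4 : ℝ) = 2 ^ 2 by norm_num, Real.log_pow]
    norm_num
  have h16 : Real.log 16 = 4 * Real.log 2 := by
    rw [show (16 : ℝ) = 2 ^ 4 by norm_num, Real.log_pow]
    norm_num
  have hαlog : 2 * Real.log 2 ≤ α * Real.log T := by nlinarith
  have hkK : 1 ≤ k₁ * K := by nlinarith
  rw [fThr_eq_log_add hK hd (by linarith) (by omega) (div_five_pow_pos hd),
    fThr_eq_log_add hK hd (by linarith) (by omega) one_pos]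
  have e1 : 4 * k₁ * K * d / (d / 5 ^ d) = 4 * (k₁ * K) * 5 ^ d := by
    field_simp
  have l1 : Real.log 16 ≤ Real.log (4 * k₁ * K * d / (d / 5 ^ d)) := by
    refine Real.log_le_log (by norm_num) ?_
    rw [e1]
    nlinarith
  have l2 : Real.log 4 ≤ Real.log (4 * k₁ * K * d / 1) := by
    refine Real.log_le_log (by norm_num) ?_
    rw [div_one]
    nlinarith
  linarith

/-- The failure probabilities are bounded by the terms of the series for `Λ_α`. -/
lemma tableLaw_badEvent_le (hK : 1 ≤ K) (hd : 1 ≤ d) {σ σu α k₁ : ℝ} (hσ : 0 < σ)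
    (hσu : 0 < σu) (hα : 2 < α) (hk₁ : 1 ≤ k₁) {ν : Fin K → ProbabilityMeasure (Vec d)}
    (hν : ∀ i, ν i ∈ subGaussianClass d σ σu) {T : ℕ} (hT : 0 < T) :
    tableLaw ν (badEvent σ σu α k₁ (fun i => mean (ν i)) T)
      ≤ ENNReal.ofReal (2 ^ (α - 1) / (4 * k₁) * lambdaTerm K d α k₁ T) := by
  obtain hT2 | hT2 := lt_or_ge T 2
  · rw [badEvent_eq_empty _ _ _ _ _ hT2, measure_empty]
    exact zero_le
  have hK' : (0 : ℝ) < K := by exact_mod_cast hK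
  have hT' : (0 : ℝ) < T := by exact_mod_cast hT
  set q : ℝ := 3 * 1 / (4 * k₁ * K) * (((T + 1) / 2 : ℕ) : ℝ) ^ (-α) with hq
  have hq0 : 0 ≤ q := by positivity
  have hone : ∀ i, ∀ n ∈ Finset.Icc 1 T,
      tableLaw ν (roundDeviation σ σu α k₁ 1 ((T + 1) / 2) n i (mean (ν i)))
        ≤ ENNReal.ofReal q := by
    intro i n hn
    rw [← ofReal_measureReal]
    exact ENNReal.ofReal_le_ofReal (tableLaw_roundDeviation_le hd hσ hσu (by linarith) hk₁ one_pos
      le_rfl (hν i) (Finset.mem_Icc.1 hn).1 (by omega))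
  have hqle : q ≤ 3 / (4 * k₁ * K) * (2 ^ α * (T : ℝ) ^ (-α)) := by
    have hhalf : (T : ℝ) / 2 ≤ (((T + 1) / 2 : ℕ) : ℝ) := by
      have : T ≤ 2 * ((T + 1) / 2) := by omega
      have : (T : ℝ) ≤ 2 * (((T + 1) / 2 : ℕ) : ℝ) := by exact_mod_cast this
      linarith
    have : (((T + 1) / 2 : ℕ) : ℝ) ^ (-α) ≤ ((T : ℝ) / 2) ^ (-α) :=
      Real.rpow_le_rpow_of_nonpos (by positivity) hhalf (by linarith)
    rw [Real.div_rpow hT'.le two_pos.le, Real.rpow_neg two_pos.le, div_inv_eq_mul,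
      mul_comm] at this
    rw [hq, mul_one]
    gcongr
  have hreal : K * (T * q) ≤ 2 ^ (α - 1) / (4 * k₁) * lambdaTerm K d α k₁ T := by
    have h6 := six_le_fThr_add_fThr (K := K) hK hd hα.le hk₁ hT2
    have hlog : 0 ≤ Real.log T := Real.log_natCast_nonneg T
    have he : 0 ≤ 2 / Real.exp 1 := by positivity
    have hTpow : (T : ℝ) * (T : ℝ) ^ (-α) = 1 / (T : ℝ) ^ (α - 1) := by
      rw [one_div, ← Real.rpow_neg hT'.le, ← Real.rpow_one_add' hT'.le (by linarith)]
      congr 1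
      ring
    have h2pow : (2 : ℝ) ^ α = 2 ^ (α - 1) * 2 := by
      rw [Real.rpow_sub_one two_ne_zero]
      field_simp
    calc K * (T * q) ≤ K * (T * (3 / (4 * k₁ * K) * (2 ^ α * (T : ℝ) ^ (-α)))) := by gcongr
      _ = 2 ^ (α - 1) / (4 * k₁) * (6 * (T * (T : ℝ) ^ (-α))) := by
          rw [h2pow]
          field_simp
          ring
      _ = 2 ^ (α - 1) / (4 * k₁) * (1 * (6 / (T : ℝ) ^ (α - 1))) := by
          rw [hTpow]
          ring
      _ ≤ _ := by
          unfold lambdaTerm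
          gcongr
          · linarith
          · linarith
  rw [badEvent_eq _ _ _ _ _ hT2]
  calc _ ≤ ∑ i : Fin K, ∑ n ∈ Finset.Icc 1 T,
        tableLaw ν (roundDeviation σ σu α k₁ 1 ((T + 1) / 2) n i (mean (ν i))) :=
        (measure_iUnion_fintype_le _ _).trans
          (Finset.sum_le_sum fun i _ => measure_biUnion_finset_le _ _)
    _ ≤ ∑ i : Fin K, ∑ n ∈ Finset.Icc 1 T, ENNReal.ofReal q :=
        Finset.sum_le_sum fun i _ => Finset.sum_le_sum (hone i)
    _ = ENNReal.ofReal (K * (T * q)) := by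
        rw [ENNReal.ofReal_mul (p := (K : ℝ)) (by positivity),
          ENNReal.ofReal_mul (p := (T : ℝ)) (by positivity)]
        simp only [Finset.sum_const, Finset.card_univ, Fintype.card_fin, Nat.card_Icc,
          nsmul_eq_mul, add_tsub_cancel_right, ENNReal.ofReal_natCast]
    _ ≤ _ := ENNReal.ofReal_le_ofReal hreal

end Failure

/-! ### The expected stopping time -/

section Expectation

variable {K d : ℕ} {b c : ℕ → Table K d → Fin K}

/-- If the snapshots of the rounds between `T / 2` and `T` are accurate and the algorithm has not
stopped by round `T`, then `T` is at most twice the sum of the bounds on the numbers of pulls. -/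
lemma le_of_lt_stopTime (hK : 1 ≤ K) (hd : 1 ≤ d) {P : Set (Vec d)} {σ σu α k₁ δ : ℝ}
    (hσ : 0 < σ) (hσu : 0 < σu) (hα : 0 ≤ α) (hk₁ : 1 ≤ k₁) (hδ0 : 0 < δ) (hδ1 : δ ≤ 1)
    (hbc : IsECAPE (input K P σ σu α k₁ δ) b c) {μ : Fin K → Vec d} {S I : Set (Fin K)}
    (hv : (S, I) ∈ validAnswers P μ) (hC : complexity σ σu P μ S I ≠ ⊤) {T : ℕ}
    (hT : 2 * K ≤ T) {x : Table K d} (hx : x ∉ badEvent σ σu α k₁ μ T)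
    (hτ : (T : ℕ∞) < stopTime (input K P σ σu α k₁ δ) b c x) :
    (T : ℝ≥0∞) ≤ 2 * (ENNReal.ofReal (16 * fThr K d α k₁ T δ) * complexity σ σu P μ S I
      + feasSum σu P μ) := by
  classical
  have : NeZero d := ⟨by omega⟩
  have hd' : (1 : ℝ) ≤ d := by exact_mod_cast hd
  have hT0 : 0 < T := by omega
  have hf0 : 0 ≤ fThr K d α k₁ T δ := fThr_nonneg hK hd hα hk₁ hT0 hδ0 (hδ1.trans hd')
  have hL0 : 0 ≤ Real.log (5 ^ d / d) :=
    Real.log_nonneg ((by norm_num : (1 : ℝ) ≤ 5).trans (five_le_five_pow_div hd))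
  -- at least `T / 2` rounds of the sampling phase, since `2 * K ≤ T`
  set t₀ := max (K + 1) ((T + 1) / 2) with ht₀
  have hcount := card_Icc_le_sum_of_pulls_le (b := b) (c := c) (x := x) (t₀ := t₀) (T := T)
    (le_max_left _ _) (fun a => (if a ∈ optSet P μ then
          max (ENNReal.ofReal (16 * fThr K d α k₁ T δ) * gapCost σ (optSet P μ ∪ S) μ a)
            (ENNReal.ofReal (4 * (4 * (fThr K d α k₁ T δ + Real.log (5 ^ d / d))))
              * feasCost σu P (μ a)) else 0)
        + (if a ∈ S then
          ENNReal.ofReal (16 * fThr K d α k₁ T δ) * gapCost σ (optSet P μ ∪ S) μ a else 0)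
        + (if a ∈ I then ENNReal.ofReal (4 * (4 * (fThr K d α k₁ T δ + Real.log (5 ^ d / d))))
              * feasCost σu P (μ a) else 0)) ?_
  · calc (T : ℝ≥0∞) ≤ 2 * ((Finset.Icc t₀ T).card : ℝ≥0∞) := by
          rw [Nat.card_Icc]
          have : T ≤ 2 * (T + 1 - t₀) := by omega
          exact_mod_cast this
      _ ≤ _ := by
          gcongr
          exact hcount.trans (sum_pull_bounds_le hv σ σu hf0 hL0 rfl)
  · intro t ht
    obtain ⟨ht1, ht2⟩ := Finset.mem_Icc.1 ht
    have htK : K + 1 ≤ t := (le_max_left _ _).trans ht1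
    have htT : (T + 1) / 2 ≤ t := (le_max_right _ _).trans ht1
    have hns : ¬ Stops (input K P σ σu α k₁ δ) (snapshot b c t x) :=
      not_stops_of_lt_stopTime htK (lt_of_le_of_lt (by exact_mod_cast ht2) hτ)
    have hacc : Accurate (input K P σ σu α k₁ δ) (snapshot b c t x) μ :=
      accurate_snapshot hK hd hα (by linarith) hδ0 hδ1 (fun _ => (T + 1) / 2) fun i =>
        ⟨by omega, htT, fun h => hx ⟨by omega, i, _,
          Finset.mem_Icc.2 ⟨pulls_pos t x i, (pulls_le htK x i).trans ht2⟩, h⟩⟩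
    obtain ⟨hleader, hchallenger⟩ := hbc.rule t x htK hns
    obtain ⟨a, ha, hbound⟩ : ∃ a, (b t x = a ∨ c t x = a) ∧
        ((a ∈ optSet P μ ∪ S ∧ (pulls b c t x a : ℝ≥0∞)
          ≤ ENNReal.ofReal (16 * fThr K d α k₁ t δ) * gapCost σ (optSet P μ ∪ S) μ a) ∨
        (a ∈ optSet P μ ∪ I ∧ (pulls b c t x a : ℝ≥0∞)
          ≤ ENNReal.ofReal (4 * gThr K d α k₁ t δ) * feasCost σu P (μ a))) :=
      hacc.exists_underexplored hσ hσu hv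
      (fun i hi => gap_pos_of_complexity_ne_top hσ hC hi) hns hleader hchallenger
    refine ⟨a, ha, ?_⟩
    have hf : fThr K d α k₁ t δ ≤ fThr K d α k₁ T δ :=
      fThr_mono hK hd hα (by linarith) (by omega) ht2 hδ0 le_rfl
    have hg : gThr K d α k₁ t δ ≤ 4 * (fThr K d α k₁ T δ + Real.log (5 ^ d / d)) := by
      rw [gThr_eq hK hd (by linarith) (by omega) hδ0]
      linarith
    obtain ⟨haO | haS, hle⟩ | ⟨haO | haI, hle⟩ := hbound
    · rw [if_pos haO, add_assoc]
      refine le_trans (hle.trans ?_) le_self_add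
      refine le_trans ?_ (le_max_left _ _)
      gcongr
    · rw [if_pos haS]
      refine le_trans (hle.trans ?_) (le_add_self.trans le_self_add)
      gcongr
    · rw [if_pos haO, add_assoc]
      refine le_trans (hle.trans ?_) le_self_add
      refine le_trans ?_ (le_max_right _ _)
      gcongr
    · rw [if_pos haI]
      refine le_trans (hle.trans ?_) le_add_self
      gcongr

lemma ENat_toENNReal_eq_tsum (m : ℕ∞) :
    (m : ℝ≥0∞) = ∑' T : ℕ, if (T : ℕ∞) < m then 1 else 0 := by
  induction m using ENat.recTopCoe with
  | top => simp
  | coe n =>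
    rw [tsum_eq_sum (s := Finset.range n) (fun T hT => by simpa using hT)]
    rw [Finset.sum_congr rfl (g := fun _ => 1) fun T hT => by simpa using hT]
    simp

/-- There are at most `⌈z - 1⌉ ≤ z` such indices `T`; the test `T + 1 < z` rather than `T < z`
absorbs the rounding. -/
lemma tsum_ite_add_one_lt_le {z : ℝ} (hz : 1 ≤ z) :
    ∑' T : ℕ, (if (T : ℝ) + 1 < z then (1 : ℝ≥0∞) else 0) ≤ ENNReal.ofReal z := by
  rw [tsum_eq_sum (s := Finset.range ⌈z - 1⌉₊) fun T hT => ?_]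
  · calc ∑ T ∈ Finset.range ⌈z - 1⌉₊, (if (T : ℝ) + 1 < z then (1 : ℝ≥0∞) else 0)
        ≤ ∑ T ∈ Finset.range ⌈z - 1⌉₊, 1 := by
          gcongr
          split_ifs <;> simp
      _ = ENNReal.ofReal (⌈z - 1⌉₊ : ℝ) := by simp
      _ ≤ _ := by
          refine ENNReal.ofReal_le_ofReal ?_
          linarith [Nat.ceil_lt_add_one (a := z - 1) (by linarith)]
  · rw [if_neg]
    simpa using hT

/-- Past the announced time, the counting bound contradicts itself: the term `2 * H` takes up at
most half of `T`, and the rest is below a multiple of `C * log T`. -/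
lemma add_one_lt_of_le (hK : 1 ≤ K) (hd : 1 ≤ d) {α k₁ δ C h : ℝ} (hα : 0 < α) (hk₁ : 1 ≤ k₁)
    (hδ0 : 0 < δ) (hC : 0 ≤ C) (hh : 0 ≤ h) {T : ℕ} (hT0 : 0 < T)
    (hT : (T : ℝ) ≤ 2 * (16 * fThr K d α k₁ T δ * C + h)) :
    (T : ℝ) + 1 < max (2 * (K : ℝ) + 1)
      (128 * α * C * Real.log (64 * α * C * (4 * k₁ * K * d / δ) ^ (1 / α))) + 4 * h := by
  by_contra! hcon
  have hK' : (1 : ℝ) ≤ K := by exact_mod_cast hK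
  have hd' : (1 : ℝ) ≤ d := by exact_mod_cast hd
  have hT' : (0 : ℝ) < T := by exact_mod_cast hT0
  set q : ℝ := (4 * k₁ * K * d / δ) ^ (1 / α) with hq
  have hbase : 0 < 4 * k₁ * K * d / δ := by positivity
  have hq0 : 0 < q := Real.rpow_pos_of_pos hbase _
  have hf : fThr K d α k₁ T δ = α * Real.log (q * T) := by
    rw [fThr_eq_log_add hK hd (by linarith) hT0 hδ0, Real.log_mul hq0.ne' hT'.ne', hq,
      Real.log_rpow hbase]
    field_simp
  have hmono : Real.log (q * T) ≤ Real.log (q * (T + 1)) :=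
    Real.log_le_log (by positivity) (by nlinarith)
  have hmul := mul_le_mul_of_nonneg_left hmono (by positivity : 0 ≤ 64 * α * C)
  have h1 := (le_max_left (2 * (K : ℝ) + 1) (128 * α * C * Real.log (64 * α * C * q)))
  have h2 := (le_max_right (2 * (K : ℝ) + 1) (128 * α * C * Real.log (64 * α * C * q)))
  rw [hf] at hT
  have hlt : (T : ℝ) + 1 < 64 * α * C * Real.log (q * (T + 1)) := by linarith
  have := lt_two_mul_log_of_lt_mul_log (by positivity) hq0 (by positivity) hlt
  linarith

theorem lintegral_stopTime_le (hK : 1 ≤ K) (hd : 1 ≤ d) {P : Set (Vec d)} {σ σu α k₁ δ : ℝ}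
    (hσ : 0 < σ) (hσu : 0 < σu) (hα : 2 < α) (hk₁ : 1 ≤ k₁) (hδ0 : 0 < δ) (hδ1 : δ ≤ 1)
    (hbc : IsECAPE (input K P σ σu α k₁ δ) b c) {ν : Fin K → ProbabilityMeasure (Vec d)}
    (hν : ∀ i, ν i ∈ subGaussianClass d σ σu) {C : ℝ} (hC : 0 ≤ C)
    (hmin : minComplexity σ σu P (fun i => mean (ν i)) = ENNReal.ofReal C) :
    ∫⁻ x, (stopTime (input K P σ σu α k₁ δ) b c x : ℝ≥0∞) ∂(tableLaw ν)
      ≤ ENNReal.ofReal (max (2 * (K : ℝ) + 1)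
          (128 * α * C * Real.log (64 * α * C * (4 * k₁ * K * d / δ) ^ (1 / α))))
        + 4 * feasSum σu P (fun i => mean (ν i)) + ENNReal.ofReal (lambdaBound K d α k₁) := by
  classical
  set μ : Fin K → Vec d := fun i => mean (ν i) with hμ
  by_cases hH : feasSum σu P μ = ⊤
  · simp [hH, ENNReal.mul_top]
  have hh0 : 0 ≤ (feasSum σu P μ).toReal := ENNReal.toReal_nonneg
  have hh : feasSum σu P μ = ENNReal.ofReal (feasSum σu P μ).toReal :=
    (ENNReal.ofReal_toReal hH).symm
  set h := (feasSum σu P μ).toReal with hhdef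
  -- there are finitely many valid answers, so one of them realizes the minimal complexity
  have hne : (validAnswers P μ).Nonempty := by
    by_contra hem
    rw [Set.not_nonempty_iff_eq_empty] at hem
    simp [minComplexity, hem] at hmin
  obtain ⟨⟨S, I⟩, hv, hargmin⟩ := Set.exists_min_image (validAnswers P μ)
    (fun q => complexity σ σu P μ q.1 q.2) (Set.toFinite _) hne
  have hcomp : complexity σ σu P μ S I = ENNReal.ofReal C :=
    hmin ▸ le_antisymm (le_iInf₂ hargmin) (iInf₂_le (S, I) hv)
  set z : ℝ := max (2 * (K : ℝ) + 1)
    (128 * α * C * Real.log (64 * α * C * (4 * k₁ * K * d / δ) ^ (1 / α))) + 4 * h with hz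
  have hK' : (1 : ℝ) ≤ K := by exact_mod_cast hK
  have hzK : 2 * (K : ℝ) + 1 ≤ z := by
    have := le_max_left (2 * (K : ℝ) + 1)
      (128 * α * C * Real.log (64 * α * C * (4 * k₁ * K * d / δ) ^ (1 / α)))
    linarith
  have hpoint : ∀ x, (stopTime (input K P σ σu α k₁ δ) b c x : ℝ≥0∞)
      ≤ ∑' T : ℕ, ((if (T : ℝ) + 1 < z then (1 : ℝ≥0∞) else 0)
        + (badEvent σ σu α k₁ μ T).indicator 1 x) := by
    intro x
    rw [ENat_toENNReal_eq_tsum]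
    refine ENNReal.tsum_le_tsum fun T => ?_
    by_cases hτ : (T : ℕ∞) < stopTime (input K P σ σu α k₁ δ) b c x
    · rw [if_pos hτ]
      by_cases hzT : (T : ℝ) + 1 < z
      · rw [if_pos hzT]
        exact le_self_add
      by_cases hx : x ∈ badEvent σ σu α k₁ μ T
      · rw [Set.indicator_of_mem hx]
        exact le_add_self
      refine absurd ?_ hzT
      have hTK : 2 * K ≤ T := by
        have : (2 * (K : ℝ)) ≤ T := by linarith
        exact_mod_cast this
      have hle := le_of_lt_stopTime hK hd hσ hσu (by linarith) hk₁ hδ0 hδ1 hbc hv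
        (by rw [hcomp]; exact ENNReal.ofReal_ne_top) hTK hx hτ
      have hf0 : 0 ≤ fThr K d α k₁ T δ := fThr_nonneg hK hd (by linarith) hk₁ (by omega) hδ0
        (hδ1.trans (by exact_mod_cast hd))
      rw [hcomp, hh, ← ENNReal.ofReal_mul (by positivity),
        ← ENNReal.ofReal_add (by positivity) hh0, ← ENNReal.ofReal_ofNat 2,
        ← ENNReal.ofReal_mul (by norm_num), ← ENNReal.ofReal_natCast,
        ENNReal.ofReal_le_ofReal_iff (by positivity)] at hle
      exact add_one_lt_of_le hK hd (by linarith) hk₁ hδ0 hC hh0 (by omega) hle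
    · rw [if_neg hτ]
      exact zero_le
  calc ∫⁻ x, (stopTime (input K P σ σu α k₁ δ) b c x : ℝ≥0∞) ∂(tableLaw ν)
      ≤ ∫⁻ x, ∑' T : ℕ, ((if (T : ℝ) + 1 < z then (1 : ℝ≥0∞) else 0)
        + (badEvent σ σu α k₁ μ T).indicator 1 x) ∂(tableLaw ν) := lintegral_mono hpoint
    _ = ∑' T : ℕ, ((if (T : ℝ) + 1 < z then (1 : ℝ≥0∞) else 0)
        + tableLaw ν (badEvent σ σu α k₁ μ T)) := by
        have hmeas : ∀ T : ℕ, Measurable fun x : Table K d =>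
            (if (T : ℝ) + 1 < z then (1 : ℝ≥0∞) else 0)
              + (badEvent σ σu α k₁ μ T).indicator 1 x := fun T =>
          measurable_const.add
            (measurable_one.indicator (measurableSet_badEvent σ σu α k₁ μ T))
        rw [lintegral_tsum fun T => (hmeas T).aemeasurable]
        refine tsum_congr fun T => ?_
        rw [lintegral_add_left measurable_const, lintegral_const, measure_univ, mul_one,
          lintegral_indicator_one (measurableSet_badEvent _ _ _ _ _ _)]
    _ = (∑' T : ℕ, if (T : ℝ) + 1 < z then (1 : ℝ≥0∞) else 0)
        + ∑' T : ℕ, tableLaw ν (badEvent σ σu α k₁ μ T) := ENNReal.tsum_add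
    _ ≤ ENNReal.ofReal z + ENNReal.ofReal (lambdaBound K d α k₁) := by
        refine add_le_add (tsum_ite_add_one_lt_le (by linarith)) ?_
        rw [tsum_eq_zero_add' ENNReal.summable, badEvent_eq_empty _ _ _ _ _ (by norm_num),
          measure_empty, zero_add]
        calc _ ≤ ∑' T : ℕ, ENNReal.ofReal
              (2 ^ (α - 1) / (4 * k₁) * lambdaTerm K d α k₁ (T + 1)) :=
              ENNReal.tsum_le_tsum fun T =>
                tableLaw_badEvent_le hK hd hσ hσu hα hk₁ hν T.succ_pos
          _ = ENNReal.ofReal (lambdaBound K d α k₁) := by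
              rw [lambdaBound, ← tsum_mul_left, ENNReal.ofReal_tsum_of_nonneg (fun T =>
                mul_nonneg (by positivity)
                  (lambdaTerm_nonneg hK hd (by linarith) hk₁ T.succ_pos))
                ((summable_lambdaTerm hK hd hα hk₁).mul_left _)]
    _ = _ := by
        rw [hz, ENNReal.ofReal_add (le_max_of_le_left (by positivity)) (by positivity),
          ENNReal.ofReal_mul (by norm_num : (0 : ℝ) ≤ 4), ← hh, ENNReal.ofReal_ofNat]

end Expectation

end ECAPE

theorem theorem1 {K d m : ℕ} (hK : 1 ≤ K) (hd : 1 ≤ d)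
    (A : Matrix (Fin m) (Fin d) ℝ) (v : Fin m → ℝ)
    (σ σu α k₁ δ : ℝ) (hσ : 0 < σ) (hσu : 0 < σu)
    (hα : 2 < α) (hk₁ : 1 + 1 / (α - 1) < k₁) (hδ0 : 0 < δ) (hδ1 : δ < 1)
    (b c : ℕ → ECAPE.Table K d → Fin K)
    (hbc : ECAPE.IsECAPE (ECAPE.input K (ECAPE.polyhedron A v) σ σu α k₁ δ) b c) :
    ECAPE.DeltaCorrect δ (ECAPE.polyhedron A v) (ECAPE.subGaussianClass d σ σu)
      (ECAPE.stopTime (ECAPE.input K (ECAPE.polyhedron A v) σ σu α k₁ δ) b c)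
      (ECAPE.recommendation (ECAPE.input K (ECAPE.polyhedron A v) σ σu α k₁ δ) b c) ∧
    Summable (fun T : ℕ => ECAPE.lambdaTerm K d α k₁ (T + 1)) ∧
    ∀ ν : Fin K → ProbabilityMeasure (ECAPE.Vec d),
      (∀ i, ν i ∈ ECAPE.subGaussianClass d σ σu) →
      ∀ C : ℝ, 0 ≤ C →
      ECAPE.minComplexity σ σu (ECAPE.polyhedron A v) (fun i => ECAPE.mean (ν i))
        = ENNReal.ofReal C →
      ∫⁻ x, (ECAPE.stopTime (ECAPE.input K (ECAPE.polyhedron A v) σ σu α k₁ δ) b c x : ℝ≥0∞)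
          ∂(ECAPE.tableLaw ν)
        ≤ ENNReal.ofReal (max (2 * K + 1)
            (128 * α * C * Real.log (64 * α * C * (4 * k₁ * K * d / δ) ^ (1 / α))))
          + 4 * ECAPE.feasSum σu (ECAPE.polyhedron A v) (fun i => ECAPE.mean (ν i))
          + ENNReal.ofReal (ECAPE.lambdaBound K d α k₁) := by
  have h1 : 0 < 1 / (α - 1) := one_div_pos.2 (by linarith)
  have hk : 1 ≤ k₁ := by linarith
  exact ⟨ECAPE.deltaCorrect hK hd _ hσ hσu (by linarith) hk₁ hδ0 hδ1.le,
    ECAPE.summable_lambdaTerm hK hd hα hk, fun ν hν C hC hmin =>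
      ECAPE.lintegral_stopTime_le hK hd hσ hσu hα hk hδ0 hδ1.le hbc hν hC hmin⟩
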